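/- Let $\kappa\in\mathbb R$. For $\kappa>0$ the perimeter bound below is $2\pi/\sqrt\kappa$; for $\kappa\le 0$ there is no bound. For points $p,x,y$ of a metric space with $p\ne x$, $p\neq y$ and $|px|+|py|+|xy|$ less than the perimeter bound, let $\tilde\angle^\kappa(p;x,y)$ be the angle at $\tilde p$ of a triangle $\tilde p\tilde x\tilde y$ with the same side lengths in the model plane of constant curvature $\kappa$; otherwise the model angle is undefined. A complete metric space with intrinsic metric (the distance of any two points is the infimum of the lengths of curves joining them) is called an Alexandrov space with curvature $\ge\kappa$ if $$\tilde\angle^\kappa(p;x,y)+\tilde\angle^\kappa(p;y,z)+\tilde\angle^\kappa(p;z,x)\le 2\pi$$ for all points $p,x,y,z$ for which the three model angles are defined. Let $\mathcal X$ be a complete space with intrinsic metric. (a) Let $\kappa>0$. If every quadruple $p,x^1,x^2,x^3\in\mathcal X$ satisfies $$\Bigl(\sum_{i=1}^3\cos(\sqrt\kappa\,|px^i|)\Bigr)^2\le\sum_{i,j=1}^3\cos(\sqrt\kappa\,|x^ix^j|),$$ then $\mathcal X$ is an Alexandrov space with curvature $\ge\kappa$. If $\operatorname{diam}\mathcal X\le\pi/\sqrt\kappa$,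 then the converse holds too, so that $\mathcal X$ is an Alexandrov space with curvature $\ge\kappa$ if and only if every quadruple satisfies this inequality. In particular, for $\kappa=1$ and $\operatorname{diam}\mathcal X\le\pi$ the characterizing inequality is $\bigl(\sum_i\cos|px^i|\bigr)^2\le\sum_{i,j}\cos|x^ix^j|$. (b) $\mathcal X$ is an Alexandrov space with curvature $\ge 0$ if and only if every quadruple $p,x,y,z\in\mathcal X$ satisfies $$|px|^2+|py|^2+|pz|^2\ge\tfrac13\bigl(|xy|^2+|yz|^2+|zx|^2\bigr).$$ (c) Let $\kappa<0$. Then $\mathcal X$ is an Alexandrov space with curvature $\ge\kappa$ if and only if every quadruple $p,x^1,x^2,x^3\in\mathcal X$ satisfies $$\Bigl(\sum_{i=1}^3\cosh(\sqrt{-\kappa}\,|px^i|)\Bigr)^2\ge\sum_{i,j=1}^3\cosh(\sqrt{-\kappa}\,|x^ix^j|).$$ In particular, for $\kappa=-1$ the inequality is $\bigl(\sum_i\cosh|px^i|\bigr)^2\ge\sum_{i,j}\cosh|x^ix^j|$. -/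

import Mathlib

namespace AlexandrovCBB

/-- The metric of `X` is intrinsic: the distance between any two points is the infimum of the
lengths of the continuous paths joining them (in particular any two points are joined by a
rectifiable path). -/
def IsIntrinsic (X : Type*) [MetricSpace X] : Prop :=
  ∀ x y : X, edist x y = ⨅ γ : Path x y, eVariationOn (γ : unitInterval → X) Set.univ

/-- The angle between the sides of lengths `a` and `b`, opposite to the side of length `c`, of a
triangle with side lengths `a`, `b`, `c` in the model plane of constant curvature `κ`
(spherical, Euclidean and hyperbolic law of cosines). -/
noncomputable def modelAngle (κ a b c : ℝ) : ℝ :=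
  if 0 < κ then
    Real.arccos ((Real.cos (√κ * c) - Real.cos (√κ * a) * Real.cos (√κ * b)) /
      (Real.sin (√κ * a) * Real.sin (√κ * b)))
  else if κ < 0 then
    Real.arccos ((Real.cosh (√(-κ) * a) * Real.cosh (√(-κ) * b) - Real.cosh (√(-κ) * c)) /
      (Real.sinh (√(-κ) * a) * Real.sinh (√(-κ) * b)))
  else
    Real.arccos ((a ^ 2 + b ^ 2 - c ^ 2) / (2 * a * b))

/-- The model angle at `p` of the triple `p, x, y` is defined: `p` differs from `x` and `y` and,
if `κ > 0`, the perimeter of the triple is less than `2π / √κ`. -/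
def AngleDefined {X : Type*} [MetricSpace X] (κ : ℝ) (p x y : X) : Prop :=
  p ≠ x ∧ p ≠ y ∧ (0 < κ → dist p x + dist p y + dist x y < 2 * Real.pi / √κ)

/-- The model angle at `p` of the triple `p, x, y`. -/
noncomputable def angleAt {X : Type*} [MetricSpace X] (κ : ℝ) (p x y : X) : ℝ :=
  modelAngle κ (dist p x) (dist p y) (dist x y)

/-- Alexandrov spaces with curvature `≥ κ`: complete spaces with intrinsic metric in which, for
every quadruple `p, x, y, z`, the three model angles at `p` sum up to at most `2π`, whenever all
three are defined. -/
structure IsAlexandrovSpace (κ : ℝ) (X : Type*) [MetricSpace X] : Prop where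
  complete : CompleteSpace X
  intrinsic : IsIntrinsic X
  comparison : ∀ p x y z : X,
    AngleDefined κ p x y → AngleDefined κ p y z → AngleDefined κ p z x →
      angleAt κ p x y + angleAt κ p y z + angleAt κ p z x ≤ 2 * Real.pi

/-- The quadruple inequality for curvature `κ > 0`. -/
def SphericalInequality (κ : ℝ) (X : Type*) [MetricSpace X] : Prop :=
  ∀ (p : X) (x : Fin 3 → X),
    (∑ i, Real.cos (√κ * dist p (x i))) ^ 2 ≤ ∑ i, ∑ j, Real.cos (√κ * dist (x i) (x j))

/-- The quadruple inequality for curvature `κ < 0`. -/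
def HyperbolicInequality (κ : ℝ) (X : Type*) [MetricSpace X] : Prop :=
  ∀ (p : X) (x : Fin 3 → X),
    ∑ i, ∑ j, Real.cosh (√(-κ) * dist (x i) (x j)) ≤ (∑ i, Real.cosh (√(-κ) * dist p (x i))) ^ 2

/-- The quadruple inequality for curvature `0`. -/
def EuclideanInequality (X : Type*) [MetricSpace X] : Prop :=
  ∀ p x y z : X,
    (1 / 3 : ℝ) * (dist x y ^ 2 + dist y z ^ 2 + dist z x ^ 2) ≤
      dist p x ^ 2 + dist p y ^ 2 + dist p z ^ 2

end AlexandrovCBB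

namespace AlexandrovCBB

open Filter Topology

/-! Three angles in `[0, π]` sum to at most `2π` exactly when the quadratic form with unit diagonal
and their cosines off the diagonal is nonnegative on nonnegative vectors. By the law of cosines,
absorbing the lengths of the sides at `p` into the weights turns this into `form3`, whose entries
are built from distances alone. At weights `1, 1, 1`, nonnegativity of `form3` is precisely the
quadruple inequality. So for `κ ≤ 0` comparison gives the inequality at once; degenerate sides are
harmless.

From the inequality to comparison, all nonnegative weights are needed. By homogeneity they may be
taken at most `1`, and a weight `ρ` is realized by sliding `x` along a shortest path towards `p`
until the sine-type function of its distance is multiplied by `ρ`. What makes this work is the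
point-on-side comparison: the mixed term with any third point is multiplied by at most `ρ`. It is
extracted from the inequality by self-improvement. The inequality gives the midpoint comparison up
to an error; reapplied at the point playing the centroid of the triangle, it shrinks the error by a
fixed factor. Doubling the shorter part of a segment passes from midpoints to arbitrary points. On
the sphere this works only for short segments, and a Sturm argument covers the whole side.

Shortest paths need not exist in an intrinsic space, so all this happens in an ultrapower of bounded
sequences, which is geodesic, inherits the inequality and contains the original space as constant
sequences.

For `κ > 0` the converse must also handle triples with undefined angles. If the diameter is at most
`π` (after rescaling), comparison forces every perimeter to be at most `2π`
(`SphericalWeighted.perimeter_le`). Shrinking three sides by one common factor then reduces to small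
triples, where all angles are defined. -/

/-! ### Angle sums at a point and quadratic forms -/

/-- If the quadratic form with off-diagonal entries `cos α`, `cos β`, `cos γ` is nonnegative on
nonnegative vectors, then `α + β + γ ≤ 2π`. -/
lemma add_angles_le_of_quadratic {α β γ : ℝ} (hα : α ∈ Set.Icc 0 Real.pi)
    (hβ : β ∈ Set.Icc 0 Real.pi) (hγ : γ ∈ Set.Icc 0 Real.pi)
    (h : ∀ a b c : ℝ, 0 ≤ a → 0 ≤ b → 0 ≤ c →
      0 ≤ a ^ 2 + b ^ 2 + c ^ 2 +
        2 * (a * b * Real.cos α + b * c * Real.cos β + c * a * Real.cos γ)) :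
    α + β + γ ≤ 2 * Real.pi := by
  by_contra hlt
  push Not at hlt
  obtain ⟨hα0, hα1⟩ := hα
  obtain ⟨hβ0, hβ1⟩ := hβ
  obtain ⟨hγ0, hγ1⟩ := hγ
  have key : ∀ x y : ℝ, 0 ≤ x → x ≤ Real.pi → 0 ≤ y → y ≤ Real.pi → Real.pi < x + y →
      Real.cos x + Real.cos y < 0 := by
    intro x y hx hx' hy hy' hxy
    have : Real.cos y < Real.cos (Real.pi - x) :=
      Real.cos_lt_cos_of_nonneg_of_le_pi (by linarith) hy' (by linarith)
    rw [Real.cos_pi_sub] at this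
    linarith
  have small : ∀ K : ℝ, K < 0 → ∃ e : ℝ, 0 ≤ e ∧ e ^ 2 + 2 * e * K < 0 := fun K hK =>
    ⟨-K, by linarith, by nlinarith⟩
  rcases hα1.eq_or_lt with rfl | hα2
  · obtain ⟨e, he, he'⟩ := small _ (key β γ hβ0 hβ1 hγ0 hγ1 (by linarith))
    have := h 1 1 e zero_le_one zero_le_one he
    rw [Real.cos_pi] at this
    nlinarith
  rcases hβ1.eq_or_lt with rfl | hβ2
  · obtain ⟨e, he, he'⟩ := small _ (key α γ hα0 hα1 hγ0 hγ1 (by linarith))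
    have := h e 1 1 he zero_le_one zero_le_one
    rw [Real.cos_pi] at this
    nlinarith
  have hs1 : 0 < Real.sin α := Real.sin_pos_of_pos_of_lt_pi (by linarith) hα2
  have hs2 : 0 < Real.sin β := Real.sin_pos_of_pos_of_lt_pi (by linarith) hβ2
  have hs3 : 0 ≤ Real.sin (2 * Real.pi - (α + β)) :=
    Real.sin_nonneg_of_nonneg_of_le_pi (by linarith) (by linarith)
  have hc : Real.cos γ < Real.cos (2 * Real.pi - (α + β)) :=
    Real.cos_lt_cos_of_nonneg_of_le_pi (by linarith) hγ1 (by linarith)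
  rw [Real.cos_two_pi_sub, Real.cos_add] at hc
  -- Planar unit vectors at successive angles `α`, `β`, `2π - α - β` satisfy a linear relation with
  -- these sines as coefficients, so the form vanishes there once `γ` is replaced by `2π - α - β`.
  -- The true `γ` is larger, which makes the value negative.
  have := h _ _ _ hs2.le hs3 hs1.le
  rw [Real.sin_two_pi_sub, Real.sin_add] at this
  have e1 := Real.sin_sq_add_cos_sq α
  have e2 := Real.sin_sq_add_cos_sq β
  have hm := mul_pos (mul_pos hs1 hs2) (sub_pos.2 hc)
  generalize Real.sin α = s at *
  generalize Real.cos α = c at *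
  generalize Real.sin β = s' at *
  generalize Real.cos β = c' at *
  generalize Real.cos γ = g at *
  have id1 : s' ^ 2 + (-(s * c' + c * s')) ^ 2 + s ^ 2 +
      2 * (s' * -(s * c' + c * s') * c + -(s * c' + c * s') * s * c' + s * s' * (c * c' - s * s'))
      = 0 := by
    have h1 : c ^ 2 = 1 - s ^ 2 := by linarith
    have h2 : c' ^ 2 = 1 - s' ^ 2 := by linarith
    linear_combination (-s' ^ 2) * h1 - s ^ 2 * h2
  nlinarith

/-- If `α + β + γ ≤ 2π`, then the quadratic form with off-diagonal entries `cos α`, `cos β`,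
`cos γ` is nonnegative on nonnegative vectors. -/
lemma quadratic_nonneg_of_add_angles_le {α β γ : ℝ} (hα : α ∈ Set.Icc 0 Real.pi)
    (hβ : β ∈ Set.Icc 0 Real.pi) (hγ : γ ∈ Set.Icc 0 Real.pi)
    (h : α + β + γ ≤ 2 * Real.pi) {a b c : ℝ} (ha : 0 ≤ a) (hb : 0 ≤ b) (hc : 0 ≤ c) :
    0 ≤ a ^ 2 + b ^ 2 + c ^ 2 +
        2 * (a * b * Real.cos α + b * c * Real.cos β + c * a * Real.cos γ) := by
  obtain ⟨hα0, hα1⟩ := hα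
  obtain ⟨hβ0, hβ1⟩ := hβ
  obtain ⟨hγ0, hγ1⟩ := hγ
  have hca := mul_nonneg hc ha
  have hab := mul_nonneg ha hb
  have e1 := Real.sin_sq_add_cos_sq α
  have e2 := Real.sin_sq_add_cos_sq β
  -- In both cases the form dominates the squared norm of a combination of planar vectors: with
  -- angles `α`, `β`, `2π - α - β` in the first, and in the second with the vectors of `a` and `c`
  -- opposite to each other.
  rcases le_total Real.pi (α + β) with hs | hs
  · have : Real.cos (2 * Real.pi - (α + β)) ≤ Real.cos γ :=
      Real.cos_le_cos_of_nonneg_of_le_pi hγ0 (by linarith) (by linarith)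
    rw [Real.cos_two_pi_sub, Real.cos_add] at this
    have h1 := mul_le_mul_of_nonneg_left this hca
    have h2 : 0 ≤ (b + a * Real.cos α + c * Real.cos β) ^ 2 +
      (a * Real.sin α - c * Real.sin β) ^ 2 := by positivity
    have h3 : (b + a * Real.cos α + c * Real.cos β) ^ 2 +
      (a * Real.sin α - c * Real.sin β) ^ 2 = a ^ 2 + b ^ 2 + c ^ 2 + 2 * (a * b * Real.cos α +
        b * c * Real.cos β + c * a * (Real.cos α * Real.cos β - Real.sin α * Real.sin β)) := by
      linear_combination a ^ 2 * e1 + c ^ 2 * e2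
    linarith
  · have : Real.cos (Real.pi - β) ≤ Real.cos α :=
      Real.cos_le_cos_of_nonneg_of_le_pi hα0 (by linarith) (by linarith)
    rw [Real.cos_pi_sub] at this
    have h1 := mul_le_mul_of_nonneg_left this hab
    have h2 := mul_le_mul_of_nonneg_left (Real.neg_one_le_cos γ) hca
    have h3 : 0 ≤ (b + (c - a) * Real.cos β) ^ 2 + (c - a) ^ 2 * Real.sin β ^ 2 := by positivity
    have h4 : (b + (c - a) * Real.cos β) ^ 2 + (c - a) ^ 2 * Real.sin β ^ 2 =
      b ^ 2 + (c - a) ^ 2 + 2 * b * (c - a) * Real.cos β := by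
      linear_combination (c - a) ^ 2 * e2
    nlinarith

lemma cos_arccos_div {u s t : ℝ} (hs : 0 < s) (ht : 0 < t) (hu : |u| ≤ s * t) :
    s * t * Real.cos (Real.arccos (u / (s * t))) = u := by
  have hst := mul_pos hs ht
  have := abs_le.1 hu
  rw [Real.cos_arccos (by rw [le_div_iff₀ hst]; linarith) (by rw [div_le_iff₀ hst]; linarith)]
  field_simp

/-- The quadratic form with diagonal entries `s ^ 2`, `t ^ 2`, `r ^ 2` and off-diagonal entries
`u`, `v`, `w`. -/
def form3 (s t r u v w a b c : ℝ) : ℝ :=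
  (a * s) ^ 2 + (b * t) ^ 2 + (c * r) ^ 2 + 2 * (a * b * u + b * c * v + c * a * w)

lemma arccos_add_le_of_form3_nonneg {s t r u v w : ℝ} (hs : 0 < s) (ht : 0 < t) (hr : 0 < r)
    (hu : |u| ≤ s * t) (hv : |v| ≤ t * r) (hw : |w| ≤ r * s)
    (h : ∀ a b c, 0 ≤ a → 0 ≤ b → 0 ≤ c → 0 ≤ form3 s t r u v w a b c) :
    Real.arccos (u / (s * t)) + Real.arccos (v / (t * r)) + Real.arccos (w / (r * s)) ≤
      2 * Real.pi := by
  refine add_angles_le_of_quadratic ⟨Real.arccos_nonneg _, Real.arccos_le_pi _⟩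
    ⟨Real.arccos_nonneg _, Real.arccos_le_pi _⟩ ⟨Real.arccos_nonneg _, Real.arccos_le_pi _⟩ ?_
  intro a b c ha hb hc
  refine (h (a / s) (b / t) (c / r) (by positivity) (by positivity) (by positivity)).trans_eq ?_
  have e1 := cos_arccos_div hs ht hu
  have e2 := cos_arccos_div ht hr hv
  have e3 := cos_arccos_div hr hs hw
  rw [form3]
  generalize Real.cos (Real.arccos (u / (s * t))) = x at *
  generalize Real.cos (Real.arccos (v / (t * r))) = y at *
  generalize Real.cos (Real.arccos (w / (r * s))) = z at *
  subst e1 e2 e3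
  field_simp

/-- A vanishing side annihilates two of the mixed terms, and the rest is a two-variable form that is
nonnegative by its bound on the third. Hence points coinciding with the apex, where no angle exists,
cost nothing. -/
lemma form3_nonneg_of_pos_imp {s t r u v w : ℝ} (hs : 0 ≤ s) (ht : 0 ≤ t) (hr : 0 ≤ r)
    (hu : |u| ≤ s * t) (hv : |v| ≤ t * r) (hw : |w| ≤ r * s)
    {a b c : ℝ} (ha : 0 ≤ a) (hb : 0 ≤ b) (hc : 0 ≤ c)
    (h : 0 < s → 0 < t → 0 < r → 0 ≤ form3 s t r u v w a b c) : 0 ≤ form3 s t r u v w a b c := by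
  have two : ∀ {x y z p q : ℝ}, |x| ≤ y * z → 0 ≤ p → 0 ≤ q →
      0 ≤ (p * y) ^ 2 + (q * z) ^ 2 + 2 * (p * q * x) := by
    intro x y z p q hx hp hq
    have h1 := mul_le_mul_of_nonneg_left (abs_le.1 hx).1 (mul_nonneg hp hq)
    nlinarith [sq_nonneg (p * y - q * z)]
  unfold form3 at h ⊢
  rcases hs.eq_or_lt with rfl | hs
  · have : u = 0 := by simpa using hu
    have : w = 0 := by simpa using hw
    subst u w
    linarith [two hv hb hc]
  rcases ht.eq_or_lt with rfl | ht
  · have : u = 0 := by simpa using hu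
    have : v = 0 := by simpa using hv
    subst u v
    linarith [two hw hc ha]
  rcases hr.eq_or_lt with rfl | hr
  · have : v = 0 := by simpa using hv
    have : w = 0 := by simpa using hw
    subst v w
    linarith [two hu ha hb]
  exact h hs ht hr

lemma form3_nonneg_of_arccos_add_le {s t r u v w : ℝ} (hs : 0 ≤ s) (ht : 0 ≤ t) (hr : 0 ≤ r)
    (hu : |u| ≤ s * t) (hv : |v| ≤ t * r) (hw : |w| ≤ r * s)
    (h : 0 < s → 0 < t → 0 < r → Real.arccos (u / (s * t)) + Real.arccos (v / (t * r)) +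
      Real.arccos (w / (r * s)) ≤ 2 * Real.pi)
    {a b c : ℝ} (ha : 0 ≤ a) (hb : 0 ≤ b) (hc : 0 ≤ c) : 0 ≤ form3 s t r u v w a b c := by
  refine form3_nonneg_of_pos_imp hs ht hr hu hv hw ha hb hc fun hs ht hr => ?_
  have e1 := cos_arccos_div hs ht hu
  have e2 := cos_arccos_div ht hr hv
  have e3 := cos_arccos_div hr hs hw
  refine (quadratic_nonneg_of_add_angles_le ⟨Real.arccos_nonneg _, Real.arccos_le_pi _⟩
    ⟨Real.arccos_nonneg _, Real.arccos_le_pi _⟩ ⟨Real.arccos_nonneg _, Real.arccos_le_pi _⟩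
    (h hs ht hr) (mul_nonneg ha hs.le) (mul_nonneg hb ht.le) (mul_nonneg hc hr.le)).trans_eq ?_
  rw [form3]
  generalize Real.cos (Real.arccos (u / (s * t))) = x at *
  generalize Real.cos (Real.arccos (v / (t * r))) = y at *
  generalize Real.cos (Real.arccos (w / (r * s))) = z at *
  subst e1 e2 e3
  ring

/-- Homogeneity. Weights at most `1` are the ones realized by shortening a side. -/
lemma form3_nonneg_of_le_one {s t r u v w : ℝ}
    (h : ∀ a b c, 0 ≤ a → a ≤ 1 → 0 ≤ b → b ≤ 1 → 0 ≤ c → c ≤ 1 → 0 ≤ form3 s t r u v w a b c)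
    {a b c : ℝ} (ha : 0 ≤ a) (hb : 0 ≤ b) (hc : 0 ≤ c) : 0 ≤ form3 s t r u v w a b c := by
  have hM : 0 < 1 + a + b + c := by positivity
  have := h (a / (1 + a + b + c)) (b / (1 + a + b + c)) (c / (1 + a + b + c)) (by positivity)
    (by rw [div_le_one hM]; linarith) (by positivity) (by rw [div_le_one hM]; linarith)
    (by positivity) (by rw [div_le_one hM]; linarith)
  have e : form3 s t r u v w a b c = (1 + a + b + c) ^ 2 * form3 s t r u v w
      (a / (1 + a + b + c)) (b / (1 + a + b + c)) (c / (1 + a + b + c)) := by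
    unfold form3
    field_simp
  rw [e]
  positivity

/-! ### Geodesics through an ultrapower -/

/-- A pseudometric `d` for which any two points are joined by a shortest path. -/
structure GeodesicDist {Y : Type*} (d : Y → Y → ℝ) : Prop where
  self : ∀ x, d x x = 0
  symm : ∀ x y, d x y = d y x
  triangle : ∀ x y z, d x z ≤ d x y + d y z
  geodesic : ∀ x y, ∃ γ : ℝ → Y, ∀ t ∈ Set.Icc 0 (d x y),
    d x (γ t) = t ∧ d (γ t) y = d x y - t ∧ ∀ s ∈ Set.Icc 0 (d x y), d (γ s) (γ t) = |s - t|

lemma GeodesicDist.nonneg {Y : Type*} {d : Y → Y → ℝ} (G : GeodesicDist d) (x y : Y) :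
    0 ≤ d x y := by
  have := G.triangle x y x
  rw [G.self, G.symm y x] at this
  linarith

lemma GeodesicDist.exists_between {Y : Type*} {d : Y → Y → ℝ} (G : GeodesicDist d) (x y : Y)
    {t : ℝ} (ht : 0 ≤ t) (ht' : t ≤ d x y) : ∃ z, d x z = t ∧ d z y = d x y - t := by
  obtain ⟨γ, hγ⟩ := G.geodesic x y
  exact ⟨γ t, (hγ t ⟨ht, ht'⟩).1, (hγ t ⟨ht, ht'⟩).2.1⟩

/-- In a space with intrinsic metric any two points are joined by almost shortest paths,
parametrized by the distance to the initial point. -/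
lemma IsIntrinsic.exists_almost_geodesic {X : Type*} [MetricSpace X] (hX : IsIntrinsic X)
    (x y : X) {ε : ℝ} (hε : 0 < ε) : ∃ γ : ℝ → X, ∀ t ∈ Set.Icc 0 (dist x y),
      dist x (γ t) = t ∧ ∀ s ∈ Set.Icc 0 t, dist (γ s) (γ t) ≤ t - s + ε ∧
        dist (γ t) y ≤ dist x y - t + ε := by
  have hlt : (⨅ γ : Path x y, eVariationOn (γ : unitInterval → X) Set.univ) <
      edist x y + ENNReal.ofReal ε := by
    rw [← hX x y]
    exact ENNReal.lt_add_right (edist_ne_top _ _) (by simpa using hε)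
  obtain ⟨c, hc⟩ := iInf_lt_iff.1 hlt
  set f : ℝ → ℝ := fun τ => dist x (c.extend τ) with hf
  have hfc : Continuous f := continuous_const.dist c.continuous_extend
  have hf0 : f 0 = 0 := by simp [hf]
  have hf1 : f 1 = dist x y := by simp [hf]
  -- First hitting times of the spheres about `x` are monotone in the radius, so the points reached
  -- appear along the path in the right order and its length controls their mutual distances.
  have least : ∀ t ∈ Set.Icc 0 (dist x y), ∃ τ, IsLeast {τ | τ ∈ Set.Icc (0 : ℝ) 1 ∧ f τ = t} τ := by
    intro t ht
    have hcomp : IsCompact {τ | τ ∈ Set.Icc (0 : ℝ) 1 ∧ f τ = t} :=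
      isCompact_Icc.inter_right (isClosed_eq hfc continuous_const)
    refine hcomp.exists_isLeast ?_
    obtain ⟨τ, h1, h2⟩ := intermediate_value_Icc (zero_le_one) hfc.continuousOn
      (show t ∈ Set.Icc (f 0) (f 1) by rwa [hf0, hf1])
    exact ⟨τ, h1, h2⟩
  choose! τ hτ using least
  refine ⟨fun t => c.extend (τ t), fun t ht => ⟨(hτ t ht).1.2, fun s hs => ?_⟩⟩
  have hs' : s ∈ Set.Icc 0 (dist x y) := ⟨hs.1, hs.2.trans ht.2⟩
  have hle : τ s ≤ τ t := by
    obtain ⟨σ, h1, h2⟩ := intermediate_value_Icc (hτ t ht).1.1.1 hfc.continuousOn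
      (show s ∈ Set.Icc (f 0) (f (τ t)) by rw [hf0, (hτ t ht).1.2]; exact hs)
    exact ((hτ s hs').2 ⟨⟨h1.1, h1.2.trans (hτ t ht).1.1.2⟩, h2⟩).trans h1.2
  set a : unitInterval := ⟨τ s, (hτ s hs').1.1⟩ with ha
  set b : unitInterval := ⟨τ t, (hτ t ht).1.1⟩ with hb
  have hab : a ≤ b := hle
  have ea : c.extend (τ s) = c a := c.extend_apply (hτ s hs').1.1
  have eb : c.extend (τ t) = c b := c.extend_apply (hτ t ht).1.1
  have v1 := eVariationOn.Icc_add_Icc (c : unitInterval → X) (s := Set.univ) (a := 0) (b := a)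
    (c := b) a.2.1 hab trivial
  have v2 := eVariationOn.Icc_add_Icc (c : unitInterval → X) (s := Set.univ) (a := 0) (b := b)
    (c := 1) b.2.1 b.2.2 trivial
  have w1 : edist x (c a) ≤ eVariationOn (c : unitInterval → X) (Set.univ ∩ Set.Icc 0 a) := by
    have := eVariationOn.edist_le (c : unitInterval → X) (s := Set.univ ∩ Set.Icc 0 a) (x := 0)
      (y := a) ⟨trivial, le_rfl, a.2.1⟩ ⟨trivial, a.2.1, le_rfl⟩
    simpa using this
  have w2 : edist (c a) (c b) ≤ eVariationOn (c : unitInterval → X) (Set.univ ∩ Set.Icc a b) :=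
    eVariationOn.edist_le _ ⟨trivial, le_rfl, hab⟩ ⟨trivial, hab, le_rfl⟩
  have w3 : edist (c b) y ≤ eVariationOn (c : unitInterval → X) (Set.univ ∩ Set.Icc b 1) := by
    have := eVariationOn.edist_le (c : unitInterval → X) (s := Set.univ ∩ Set.Icc b 1) (x := b)
      (y := 1) ⟨trivial, le_rfl, b.2.2⟩ ⟨trivial, b.2.2, le_rfl⟩
    simpa using this
  have tot : edist x (c a) + edist (c a) (c b) + edist (c b) y ≤ edist x y + ENNReal.ofReal ε :=
    calc _ ≤ eVariationOn (c : unitInterval → X) (Set.univ ∩ Set.Icc 0 1) := by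
          rw [← v2, ← v1]; gcongr
      _ ≤ eVariationOn (c : unitInterval → X) Set.univ := eVariationOn.mono _ (by simp)
      _ ≤ _ := hc.le
  simp only [edist_dist] at tot
  rw [← ENNReal.ofReal_add dist_nonneg dist_nonneg, ← ENNReal.ofReal_add (by positivity)
    dist_nonneg, ← ENNReal.ofReal_add dist_nonneg hε.le,
    ENNReal.ofReal_le_ofReal_iff (by positivity)] at tot
  have d1 : dist x (c a) = s := by rw [← ea]; exact (hτ s hs').1.2
  have d2 : dist x (c b) = t := by rw [← eb]; exact (hτ t ht).1.2
  have d3 := dist_triangle x (c b) y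
  have d4 := dist_triangle x (c a) (c b)
  dsimp only
  rw [ea, eb]
  constructor <;> linarith

/-- Bounded sequences of points. -/
def BddSeq (X : Type*) [MetricSpace X] : Type _ :=
  {u : ℕ → X // Bornology.IsBounded (Set.range u)}

/-- The limit along an ultrafilter of the distances, rescaled by `k`, of two sequences. -/
noncomputable def ultraDist {X : Type*} [MetricSpace X] (k : ℝ) (u v : BddSeq X) : ℝ :=
  limUnder (hyperfilter ℕ : Filter ℕ) fun n => k * dist (u.1 n) (v.1 n)

/-- The constant sequence. -/
def BddSeq.const {X : Type*} [MetricSpace X] (x : X) : BddSeq X :=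
  ⟨fun _ => x, Bornology.isBounded_singleton.subset (by rintro _ ⟨_, rfl⟩; rfl)⟩

section ultra

variable {X : Type*} [MetricSpace X] {k : ℝ}

lemma BddSeq.exists_dist_le (u v : BddSeq X) : ∃ M, ∀ n, dist (u.1 n) (v.1 n) ≤ M := by
  obtain ⟨M, hM⟩ := Metric.isBounded_iff.1 (u.2.union v.2)
  exact ⟨M, fun n => hM (Or.inl ⟨n, rfl⟩) (Or.inr ⟨n, rfl⟩)⟩

lemma tendsto_ultraDist (k : ℝ) (u v : BddSeq X) :
    Tendsto (fun n => k * dist (u.1 n) (v.1 n)) (hyperfilter ℕ) (𝓝 (ultraDist k u v)) := by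
  obtain ⟨M, hM⟩ := u.exists_dist_le v
  refine tendsto_nhds_limUnder ?_
  obtain ⟨a, -, ha⟩ := (isCompact_Icc (a := 0) (b := M)).ultrafilter_le_nhds
    ((hyperfilter ℕ).map fun n => dist (u.1 n) (v.1 n)) (by
      rw [le_principal_iff]
      exact mem_map.2 (univ_mem' fun n => ⟨dist_nonneg, hM n⟩))
  exact ⟨k * a, Tendsto.const_mul k (show Tendsto _ _ _ from ha)⟩

lemma ultraDist_eq {u v : BddSeq X} {a : ℝ}
    (h : Tendsto (fun n => k * dist (u.1 n) (v.1 n)) (hyperfilter ℕ) (𝓝 a)) :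
    ultraDist k u v = a :=
  tendsto_nhds_unique (tendsto_ultraDist k u v) h

lemma ultraDist_const (k : ℝ) (x y : X) :
    ultraDist k (BddSeq.const x) (BddSeq.const y) = k * dist x y :=
  ultraDist_eq tendsto_const_nhds

lemma tendsto_one_div_hyperfilter :
    Tendsto (fun n : ℕ => 1 / ((n : ℝ) + 1)) (hyperfilter ℕ) (𝓝 0) :=
  tendsto_one_div_add_atTop_nhds_zero_nat.mono_left Nat.hyperfilter_le_atTop

/-- Almost shortest paths with error `1 / (n + 1)` in the `n`-th coordinate have an exact shortest
path as their ultralimit. -/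
lemma geodesicDist_ultraDist (hX : IsIntrinsic X) (hk : 0 < k) :
    GeodesicDist (ultraDist (X := X) k) := by
  have hself : ∀ u : BddSeq X, ultraDist k u u = 0 := fun u => ultraDist_eq (by simp)
  have hsymm : ∀ u v : BddSeq X, ultraDist k u v = ultraDist k v u := fun u v =>
    ultraDist_eq (by simpa only [dist_comm] using tendsto_ultraDist k v u)
  have htri : ∀ u v w : BddSeq X, ultraDist k u w ≤ ultraDist k u v + ultraDist k v w :=
    fun u v w => le_of_tendsto_of_tendsto' (tendsto_ultraDist k u w)
      ((tendsto_ultraDist k u v).add (tendsto_ultraDist k v w)) fun n => by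
        rw [← mul_add]
        exact mul_le_mul_of_nonneg_left (dist_triangle _ _ _) hk.le
  refine ⟨hself, hsymm, htri, fun u v => ?_⟩
  have hpos : ∀ n : ℕ, 0 < 1 / ((n : ℝ) + 1) := fun n => by positivity
  choose γ hγ using fun n => hX.exists_almost_geodesic (u.1 n) (v.1 n) (hpos n)
  -- The parameter `t / k` may exceed the `n`-th distance, so it is clamped; the clamping disappears
  -- in the limit.
  set θ : ℝ → ℕ → ℝ := fun t n => min (max 0 (t / k)) (dist (u.1 n) (v.1 n)) with hθ
  have hθm : ∀ t n, θ t n ∈ Set.Icc 0 (dist (u.1 n) (v.1 n)) := fun t n =>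
    ⟨le_min (le_max_left _ _) dist_nonneg, min_le_right _ _⟩
  obtain ⟨M, hM⟩ := u.exists_dist_le v
  have hbdd : ∀ t, Bornology.IsBounded (Set.range fun n => γ n (θ t n)) := by
    intro t
    obtain ⟨C, hC⟩ := Metric.isBounded_iff.1 u.2
    refine Metric.isBounded_iff.2 ⟨M + C + M, ?_⟩
    rintro _ ⟨n, rfl⟩ _ ⟨m, rfl⟩
    have h1 := (hγ n _ (hθm t n)).1
    have h2 := (hγ m _ (hθm t m)).1
    have h3 := hC ⟨n, rfl⟩ ⟨m, rfl⟩
    have h4 := dist_triangle4 (γ n (θ t n)) (u.1 n) (u.1 m) (γ m (θ t m))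
    have h5 := (hθm t n).2.trans (hM n)
    have h6 := (hθm t m).2.trans (hM m)
    rw [dist_comm _ (u.1 n), h1, h2] at h4
    dsimp only
    linarith
  have hθt : ∀ t ∈ Set.Icc 0 (ultraDist k u v),
      Tendsto (fun n => k * θ t n) (hyperfilter ℕ) (𝓝 t) := by
    intro t ht
    have h := (tendsto_const_nhds (x := t)).min (tendsto_ultraDist k u v)
    rw [min_eq_left ht.2] at h
    refine h.congr fun n => ?_
    simp only [hθ]
    rw [max_eq_right (div_nonneg ht.1 hk.le), mul_min_of_nonneg _ _ hk.le, mul_div_cancel₀ _ hk.ne']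
  have hmono : ∀ {s t : ℝ}, s ≤ t → ∀ n, θ s n ≤ θ t n := fun hst n =>
    min_le_min_right _ (max_le_max_left _ (div_le_div_of_nonneg_right hst hk.le))
  set Γ : ℝ → BddSeq X := fun t => ⟨fun n => γ n (θ t n), hbdd t⟩ with hΓ
  have A1 : ∀ t ∈ Set.Icc 0 (ultraDist k u v), ultraDist k u (Γ t) = t := fun t ht =>
    ultraDist_eq ((hθt t ht).congr fun n => by rw [(hγ n _ (hθm t n)).1])
  have A2 : ∀ t ∈ Set.Icc 0 (ultraDist k u v), ∀ s ∈ Set.Icc 0 (ultraDist k u v), s ≤ t →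
      ultraDist k (Γ s) (Γ t) = t - s := by
    intro t ht s hs hst
    refine le_antisymm ?_ ?_
    · have h := ((hθt t ht).sub (hθt s hs)).add (tendsto_one_div_hyperfilter.const_mul k)
      rw [mul_zero, add_zero] at h
      refine le_of_tendsto_of_tendsto' (tendsto_ultraDist k _ _) h fun n => ?_
      rw [← mul_sub, ← mul_add]
      exact mul_le_mul_of_nonneg_left
        ((hγ n _ (hθm t n)).2 _ ⟨(hθm s n).1, hmono hst n⟩).1 hk.le
    · have := htri u (Γ s) (Γ t)
      rw [A1 t ht, A1 s hs] at this
      linarith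
  refine ⟨Γ, fun t ht => ⟨A1 t ht, le_antisymm ?_ ?_, fun s hs => ?_⟩⟩
  · have h := ((tendsto_ultraDist k u v).sub (hθt t ht)).add
      (tendsto_one_div_hyperfilter.const_mul k)
    rw [mul_zero, add_zero] at h
    refine le_of_tendsto_of_tendsto' (tendsto_ultraDist k _ _) h fun n => ?_
    rw [← mul_sub, ← mul_add]
    exact mul_le_mul_of_nonneg_left
      ((hγ n _ (hθm t n)).2 _ ⟨(hθm t n).1, le_rfl⟩).2 hk.le
  · have := htri u (Γ t) v
    rw [A1 t ht] at this
    linarith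
  · rcases le_total s t with h | h
    · rw [A2 t ht s hs h, abs_sub_comm, abs_of_nonneg (by linarith)]
    · rw [hsymm, A2 s hs t ht h, abs_of_nonneg (by linarith)]

end ultra

/-! ### Contraction of errors and sliding of points -/

lemma le_of_forall_le_add_pow_mul {a b q M : ℝ} (hq : 0 ≤ q) (hq' : q < 1)
    (h : ∀ n : ℕ, a ≤ b + q ^ n * M) : a ≤ b := by
  have := ((tendsto_pow_atTop_nhds_zero_of_lt_one hq hq').mul_const M).const_add b
  rw [zero_mul, add_zero] at this
  exact ge_of_tendsto' this h

/-- Two points are moved one after the other. The relation `R` carries the side condition under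
which a move is controlled; it has to survive the first move for the second to apply. -/
lemma mul_scale_le {Y : Type*} {u : Y → Y → ℝ} (hu : ∀ x y, u x y = u y x) {R : Y → Y → Prop}
    (hR : ∀ x y, R x y → R y x) {x x' y y' : Y} {ρ ν : ℝ} (hν : 0 ≤ ν)
    (hx : ∀ z, R x z → u x' z ≤ ρ * u x z ∧ R x' z)
    (hy : ∀ z, R y z → u y' z ≤ ν * u y z ∧ R y' z) (h : R x y) :
    u x' y' ≤ ρ * ν * u x y := by
  obtain ⟨h1, h2⟩ := hx y h
  obtain ⟨h3, -⟩ := hy x' (hR _ _ h2)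
  rw [hu, hu y] at h3
  calc u x' y' ≤ ν * u x' y := h3
    _ ≤ ν * (ρ * u x y) := by gcongr
    _ = _ := by ring

section

variable {Y : Type*} {d : Y → Y → ℝ}

lemma GeodesicDist.congr_left (G : GeodesicDist d) {x y : Y} (h : d x y = 0) (z : Y) :
    d x z = d y z := by
  have h1 := G.triangle x y z
  have h2 := G.triangle y x z
  rw [G.symm y x] at h2
  linarith

/-! ### Curvature bounded below by zero -/

/-- The inequality at `z` gives the claim with an extra `d z w ^ 2`. Applied at the point one third
of the way from `z` to `w`, the centroid of the model triangle, where the inequality is sharp, it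
reduces the error by the factor `1 / 3`. -/
lemma GeodesicDist.euclidean_midpoint (G : GeodesicDist d)
    (I : ∀ p x y z, (1 / 3 : ℝ) * (d x y ^ 2 + d y z ^ 2 + d z x ^ 2) ≤
      d p x ^ 2 + d p y ^ 2 + d p z ^ 2)
    {x y z : Y} {t : ℝ} (hx : d x z = t) (hy : d z y = t) (hxy : d x y = 2 * t) (w : Y) :
    d x w ^ 2 + d y w ^ 2 ≤ 2 * t ^ 2 + 2 * d z w ^ 2 := by
  have key : ∀ (n : ℕ) (w : Y), d x w ^ 2 + d y w ^ 2 ≤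
      2 * t ^ 2 + 2 * d z w ^ 2 + (1 / 3 : ℝ) ^ n * d z w ^ 2 := by
    intro n
    induction n with
    | zero =>
      intro w
      have := I z x y w
      rw [G.symm z x, hx, hy, hxy, G.symm w x] at this
      linarith
    | succ n ih =>
      intro w
      have hs := G.nonneg z w
      obtain ⟨v, h1, h2⟩ := G.exists_between z w (t := d z w / 3) (by linarith) (by linarith)
      have h3 := ih v
      have h4 := I v x y w
      rw [h1] at h3
      rw [G.symm v x, G.symm v y, hxy, G.symm w x, h2] at h4
      rw [pow_succ (1 / 3 : ℝ)]
      linarith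
  exact le_of_forall_le_add_pow_mul (by norm_num) (by norm_num) fun n => key n w

/-- Stewart's inequality. With `a ≤ b`, mark `v` beyond `z` at distance `a`: then `z` is the
midpoint of `x` and `v`, while `v` divides the same segment into `2a` and `b - a`. The midpoint case
expresses twice the defect at `z` through the defect at `v`, so each doubling halves the error. -/
lemma GeodesicDist.euclidean_between (G : GeodesicDist d)
    (I : ∀ p x y z, (1 / 3 : ℝ) * (d x y ^ 2 + d y z ^ 2 + d z x ^ 2) ≤
      d p x ^ 2 + d p y ^ 2 + d p z ^ 2)
    {x y z : Y} {a b : ℝ} (hx : d x z = a) (hy : d z y = b) (hxy : d x y = a + b) (w : Y) :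
    b * d x w ^ 2 + a * d y w ^ 2 ≤ (a + b) * (d z w ^ 2 + a * b) := by
  have key : ∀ (n : ℕ) (x y z : Y) (a b : ℝ), d x z = a → d z y = b → d x y = a + b →
      b * d x w ^ 2 + a * d y w ^ 2 ≤ (a + b) * (d z w ^ 2 + a * b) +
        (1 / 2 : ℝ) ^ n * (d x y * (d x w ^ 2 + d y w ^ 2)) := by
    intro n
    induction n with
    | zero =>
      intro x y z a b hx hy hxy
      have ha : 0 ≤ a := hx ▸ G.nonneg x z
      have hb : 0 ≤ b := hy ▸ G.nonneg z y
      rw [hxy]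
      have : 0 ≤ (a + b) * (d z w ^ 2 + a * b) := by positivity
      have h1 : 0 ≤ a * d x w ^ 2 := by positivity
      have h2 : 0 ≤ b * d y w ^ 2 := by positivity
      linarith
    | succ n ih =>
      intro x y z a b hx hy hxy
      wlog hab : a ≤ b generalizing x y z a b
      · have := this y x z b a (by rw [G.symm, hy]) (by rw [G.symm, hx])
          (by rw [G.symm, hxy]; ring) (by linarith)
        rw [G.symm y x] at this
        linarith
      have ha : 0 ≤ a := hx ▸ G.nonneg x z
      obtain ⟨v, h1, h2⟩ := G.exists_between z y ha (by rw [hy]; exact hab)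
      rw [hy] at h2
      have hxv : d x v = 2 * a := by
        have h3 := G.triangle x z v
        have h4 := G.triangle x v y
        linarith
      have h5 := G.euclidean_midpoint I hx h1 hxv w
      have h6 := ih x y v (2 * a) (b - a) hxv h2 (by rw [hxy]; ring)
      rw [hxy] at h6 ⊢
      have h7 := mul_le_mul_of_nonneg_left h5 (show 0 ≤ a + b by linarith)
      rw [pow_succ (1 / 2 : ℝ)]
      linarith
  exact le_of_forall_le_add_pow_mul (by norm_num) (by norm_num) fun n => key n x y z a b hx hy hxy

/-- Sliding the three points towards `p` by the factors `a`, `b`, `c` turns the unweighted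
inequality into the weighted one. -/
lemma GeodesicDist.euclidean_weighted (G : GeodesicDist d)
    (I : ∀ p x y z, (1 / 3 : ℝ) * (d x y ^ 2 + d y z ^ 2 + d z x ^ 2) ≤
      d p x ^ 2 + d p y ^ 2 + d p z ^ 2) (p x y z : Y) {a b c : ℝ} (ha : 0 ≤ a) (hb : 0 ≤ b)
    (hc : 0 ≤ c) :
    0 ≤ form3 (d p x) (d p y) (d p z) ((d p x ^ 2 + d p y ^ 2 - d x y ^ 2) / 2)
      ((d p y ^ 2 + d p z ^ 2 - d y z ^ 2) / 2) ((d p z ^ 2 + d p x ^ 2 - d z x ^ 2) / 2) a b c := by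
  refine form3_nonneg_of_le_one ?_ ha hb hc
  intro a b c ha ha' hb hb' hc hc'
  set u : Y → Y → ℝ := fun x y => (d p x ^ 2 + d p y ^ 2 - d x y ^ 2) / 2 with hu
  have husymm : ∀ x y, u x y = u y x := fun x y => by simp only [hu, G.symm x y]; ring
  have scale : ∀ (x : Y) (ρ : ℝ), 0 ≤ ρ → ρ ≤ 1 → ∃ x', d p x' = ρ * d p x ∧
      ∀ w, True → u x' w ≤ ρ * u x w ∧ True := by
    intro x ρ h0 h1
    have hL := G.nonneg p x
    rcases hL.eq_or_lt with hL | hL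
    · refine ⟨x, by rw [← hL]; simp, fun w _ => ⟨?_, trivial⟩⟩
      have : u x w = 0 := by simp [hu, ← hL, G.congr_left hL.symm w]
      simp [this]
    · obtain ⟨v, h2, h3⟩ := G.exists_between p x (t := ρ * d p x) (by positivity)
        (mul_le_of_le_one_left hL.le h1)
      refine ⟨v, h2, fun w _ => ⟨?_, trivial⟩⟩
      have h4 := G.euclidean_between I h2 h3 (by ring) w
      have h5 : (1 - ρ) * d p w ^ 2 + ρ * d x w ^ 2 ≤
          d v w ^ 2 + ρ * (1 - ρ) * d p x ^ 2 := by
        refine le_of_mul_le_mul_left ?_ hL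
        linarith
      simp only [hu, h2]
      linarith
  obtain ⟨x', hx, hx'⟩ := scale x a ha ha'
  obtain ⟨y', hy, hy'⟩ := scale y b hb hb'
  obtain ⟨z', hz, hz'⟩ := scale z c hc hc'
  have h1 := mul_scale_le husymm (R := fun _ _ => True) (fun _ _ h => h) hb hx' hy' trivial
  have h2 := mul_scale_le husymm (R := fun _ _ => True) (fun _ _ h => h) hc hy' hz' trivial
  have h3 := mul_scale_le husymm (R := fun _ _ => True) (fun _ _ h => h) ha hz' hx' trivial
  have h4 := I p x' y' z'
  simp only [hu] at h1 h2 h3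
  rw [form3]
  rw [hx, hy, hz] at h4
  rw [hx, hy] at h1
  rw [hy, hz] at h2
  rw [hz, hx] at h3
  linarith

/-! ### Negative lower curvature bound -/

lemma GeodesicDist.hyperbolic_midpoint (G : GeodesicDist d)
    (I : ∀ p x y z, 3 + 2 * (Real.cosh (d x y) + Real.cosh (d y z) + Real.cosh (d z x)) ≤
      (Real.cosh (d p x) + Real.cosh (d p y) + Real.cosh (d p z)) ^ 2)
    {x y z : Y} {t : ℝ} (hx : d x z = t) (hy : d z y = t) (hxy : d x y = 2 * t) (w : Y) :
    Real.cosh (d x w) + Real.cosh (d y w) ≤ 2 * Real.cosh t * Real.cosh (d z w) := by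
  set T := Real.cosh t with hT
  have hT1 : 1 ≤ T := Real.one_le_cosh t
  have h2t : Real.cosh (2 * t) = 2 * T ^ 2 - 1 := by
    rw [Real.cosh_two_mul, Real.sinh_sq]; ring
  have key : ∀ (n : ℕ) (w : Y), Real.cosh (d x w) + Real.cosh (d y w) ≤
      2 * T * Real.cosh (d z w) + (1 / 2 : ℝ) ^ n * (1 / 2 * Real.sinh (d z w) ^ 2) := by
    intro n
    induction n with
    | zero =>
      intro w
      have := I z x y w
      rw [G.symm z x, hx, hy, hxy, G.symm w x, h2t] at this
      rw [Real.sinh_sq]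
      nlinarith
    | succ n ih =>
      intro w
      have hs := G.nonneg z w
      set s := d z w
      set C := Real.cosh s with hC
      set S := Real.sinh s with hS
      have hC1 : 1 ≤ C := Real.one_le_cosh s
      have hS0 : 0 ≤ S := Real.sinh_nonneg_iff.2 hs
      have hCS : C ^ 2 = S ^ 2 + 1 := Real.cosh_sq s
      have hTC : 1 ≤ T * C := one_le_mul_of_one_le_of_one_le hT1 hC1
      -- In the hyperboloid model the unit vectors satisfy `x + y = 2 T z`, and `N` is the norm of
      -- `x + y + w`. The point at distance `s'` from `z` is the normalized sum, at which the
      -- inequality is sharp.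
      set N := √(4 * T ^ 2 + 1 + 4 * T * C) with hN
      have hN2 : N ^ 2 = 4 * T ^ 2 + 1 + 4 * T * C := Real.sq_sqrt (by nlinarith)
      have hN3 : 3 ≤ N := Real.le_sqrt_of_sq_le (by nlinarith)
      have hN0 : 0 < N := by linarith
      have hN4 : 4 * C ≤ N ^ 2 := by nlinarith
      set s' := Real.arsinh (S / N) with hs'
      have hsinh : Real.sinh s' = S / N := Real.sinh_arsinh _
      have hs'0 : 0 ≤ s' := Real.arsinh_nonneg_iff.2 (by positivity)
      have hs's : s' ≤ s := by
        rw [← Real.sinh_le_sinh, hsinh]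
        exact div_le_self hS0 (by linarith)
      have hcosh : Real.cosh s' = (2 * T + C) / N := by
        refine (sq_eq_sq₀ (Real.cosh_pos _).le (by positivity)).1 ?_
        rw [Real.cosh_sq, hsinh, div_pow, div_pow, div_add_one (by positivity), hN2]
        congr 1
        linear_combination -hCS
      have hcosh' : Real.cosh (s - s') = (1 + 2 * T * C) / N := by
        rw [Real.cosh_sub, hsinh, hcosh, ← hC, ← hS, ← mul_div_assoc, ← mul_div_assoc, ← sub_div]
        congr 1
        linear_combination hCS
      obtain ⟨v, h1, h2⟩ := G.exists_between z w hs'0 hs's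
      have h3 := ih v
      have h4 := I v x y w
      rw [h1, hcosh, hsinh] at h3
      rw [G.symm v x, G.symm v y, hxy, G.symm w x, h2, h2t, hcosh'] at h4
      set K := (1 / 2 : ℝ) ^ n with hK
      have hK0 : 0 < K := by positivity
      have hK1 : K ≤ 1 := pow_le_one₀ (by norm_num) (by norm_num)
      set E := K * (1 / 2 * (S / N) ^ 2) with hE
      have hE0 : 0 ≤ E := by positivity
      have e1 : 2 * T * ((2 * T + C) / N) + (1 + 2 * T * C) / N = N := by
        rw [← mul_div_assoc, ← add_div, div_eq_iff hN0.ne']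
        linear_combination -hN2
      have h5 : Real.cosh (d x v) + Real.cosh (d y v) + (1 + 2 * T * C) / N ≤ N + E := by
        linarith
      have h6 : 0 ≤ Real.cosh (d x v) + Real.cosh (d y v) + (1 + 2 * T * C) / N := by
        have := Real.cosh_pos (d x v)
        have := Real.cosh_pos (d y v)
        positivity
      have h7 := h4.trans (pow_le_pow_left₀ h6 h5 2)
      -- Halving the error allows a total excess of `K * S ^ 2 / 2`; the two terms of the expanded
      -- square contribute at most `1 / 3` and `1 / 64` of `K * S ^ 2`.
      have e2 : 2 * N * E ≤ K * S ^ 2 / 3 := by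
        have : 2 * N * E = K * S ^ 2 / N := by rw [hE]; field_simp
        rw [this]
        exact div_le_div_of_nonneg_left (by positivity) (by norm_num) hN3
      have hSN : 16 * S ^ 2 ≤ N ^ 4 := by
        have := pow_le_pow_left₀ (by linarith) hN4 2
        linarith
      have e3 : E ^ 2 ≤ K * S ^ 2 / 64 := by
        have h8 : E ^ 2 = K ^ 2 * S ^ 2 * S ^ 2 / (4 * N ^ 4) := by rw [hE]; field_simp; ring
        rw [h8, div_le_iff₀ (by positivity)]
        have h9 : K ^ 2 ≤ K := by nlinarith
        calc K ^ 2 * S ^ 2 * S ^ 2 ≤ K * S ^ 2 * S ^ 2 := by gcongr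
          _ = K * S ^ 2 / 64 * (4 * (16 * S ^ 2)) := by ring
          _ ≤ _ := by gcongr
      have : 0 ≤ K * S ^ 2 := by positivity
      rw [pow_succ (1 / 2 : ℝ), ← hK]
      have h10 : (N + E) ^ 2 = N ^ 2 + 2 * N * E + E ^ 2 := by ring
      rw [h10, hN2] at h7
      linarith
  exact le_of_forall_le_add_pow_mul (by norm_num) (by norm_num) fun n => key n w

lemma GeodesicDist.hyperbolic_between (G : GeodesicDist d)
    (I : ∀ p x y z, 3 + 2 * (Real.cosh (d x y) + Real.cosh (d y z) + Real.cosh (d z x)) ≤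
      (Real.cosh (d p x) + Real.cosh (d p y) + Real.cosh (d p z)) ^ 2)
    {x y z : Y} {a b : ℝ} (hx : d x z = a) (hy : d z y = b) (hxy : d x y = a + b) (w : Y) :
    Real.sinh b * Real.cosh (d x w) + Real.sinh a * Real.cosh (d y w) ≤
      Real.sinh (a + b) * Real.cosh (d z w) := by
  have key : ∀ (n : ℕ) (x y z : Y) (a b : ℝ), d x z = a → d z y = b → d x y = a + b →
      Real.sinh b * Real.cosh (d x w) + Real.sinh a * Real.cosh (d y w) ≤
      Real.sinh (a + b) * Real.cosh (d z w) +
        (1 / 2 : ℝ) ^ n * (Real.sinh (d x y) * (Real.cosh (d x w) + Real.cosh (d y w))) := by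
    intro n
    induction n with
    | zero =>
      intro x y z a b hx hy hxy
      have ha : 0 ≤ a := hx ▸ G.nonneg x z
      have hb : 0 ≤ b := hy ▸ G.nonneg z y
      rw [hxy]
      have h1 : Real.sinh a ≤ Real.sinh (a + b) := Real.sinh_le_sinh.2 (by linarith)
      have h2 : Real.sinh b ≤ Real.sinh (a + b) := Real.sinh_le_sinh.2 (by linarith)
      have h3 : 0 ≤ Real.sinh (a + b) := Real.sinh_nonneg_iff.2 (by linarith)
      have h4 := mul_le_mul_of_nonneg_right h2 (Real.cosh_pos (d x w)).le
      have h5 := mul_le_mul_of_nonneg_right h1 (Real.cosh_pos (d y w)).le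
      have h6 := mul_nonneg h3 (Real.cosh_pos (d z w)).le
      linarith
    | succ n ih =>
      intro x y z a b hx hy hxy
      wlog hab : a ≤ b generalizing x y z a b
      · have := this y x z b a (by rw [G.symm, hy]) (by rw [G.symm, hx])
          (by rw [G.symm, hxy]; ring) (by linarith)
        rw [G.symm y x, add_comm b a] at this
        linarith
      have ha : 0 ≤ a := hx ▸ G.nonneg x z
      obtain ⟨v, h1, h2⟩ := G.exists_between z y ha (by rw [hy]; exact hab)
      rw [hy] at h2
      have hxv : d x v = 2 * a := by
        have h3 := G.triangle x z v
        have h4 := G.triangle x v y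
        linarith
      have h5 := G.hyperbolic_midpoint I hx h1 hxv w
      have h6 := ih x y v (2 * a) (b - a) hxv h2 (by rw [hxy]; ring)
      rw [show 2 * a + (b - a) = a + b by ring, hxy] at h6
      rw [hxy]
      have hL : 0 ≤ Real.sinh (a + b) := Real.sinh_nonneg_iff.2 (by linarith)
      have h7 := mul_le_mul_of_nonneg_left h5 hL
      -- These identities combine the midpoint estimate and the estimate at `v` into `2 * cosh a`
      -- times the defect at `z`; since `cosh a ≥ 1`, the error is halved.
      have e1 : Real.sinh (a + b) + Real.sinh (b - a) = 2 * Real.cosh a * Real.sinh b := by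
        rw [Real.sinh_add, Real.sinh_sub]; ring
      have e2 : Real.sinh (2 * a) = 2 * Real.cosh a * Real.sinh a := by
        rw [Real.sinh_two_mul]; ring
      set M := Real.sinh (a + b) * (Real.cosh (d x w) + Real.cosh (d y w)) with hM
      have hM0 : 0 ≤ M := mul_nonneg hL (add_nonneg (Real.cosh_pos _).le (Real.cosh_pos _).le)
      have hK : 0 ≤ (1 / 2 : ℝ) ^ n * M := by positivity
      have hA := Real.one_le_cosh a
      set D := Real.sinh b * Real.cosh (d x w) + Real.sinh a * Real.cosh (d y w) -
        Real.sinh (a + b) * Real.cosh (d z w) with hD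
      have h8 : 2 * Real.cosh a * D ≤ (1 / 2 : ℝ) ^ n * M := by
        have e3 : 2 * Real.cosh a * D = (2 * Real.cosh a * Real.sinh b) * Real.cosh (d x w) +
          (2 * Real.cosh a * Real.sinh a) * Real.cosh (d y w) -
          Real.sinh (a + b) * (2 * Real.cosh a * Real.cosh (d z w)) := by rw [hD]; ring
        rw [e3, ← e1, ← e2]
        linarith
      have h9 : 2 * D ≤ (1 / 2 : ℝ) ^ n * M := by
        rcases le_total D 0 with h | h
        · linarith
        · nlinarith
      rw [pow_succ (1 / 2 : ℝ)]
      linarith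
  exact le_of_forall_le_add_pow_mul (by norm_num) (by norm_num) fun n => key n x y z a b hx hy hxy

lemma GeodesicDist.hyperbolic_weighted (G : GeodesicDist d)
    (I : ∀ p x y z, 3 + 2 * (Real.cosh (d x y) + Real.cosh (d y z) + Real.cosh (d z x)) ≤
      (Real.cosh (d p x) + Real.cosh (d p y) + Real.cosh (d p z)) ^ 2)
    (p x y z : Y) {a b c : ℝ} (ha : 0 ≤ a) (hb : 0 ≤ b) (hc : 0 ≤ c) :
    0 ≤ form3 (Real.sinh (d p x)) (Real.sinh (d p y)) (Real.sinh (d p z))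
      (Real.cosh (d p x) * Real.cosh (d p y) - Real.cosh (d x y))
      (Real.cosh (d p y) * Real.cosh (d p z) - Real.cosh (d y z))
      (Real.cosh (d p z) * Real.cosh (d p x) - Real.cosh (d z x)) a b c := by
  refine form3_nonneg_of_le_one ?_ ha hb hc
  intro a b c ha ha' hb hb' hc hc'
  set u : Y → Y → ℝ := fun x y => Real.cosh (d p x) * Real.cosh (d p y) - Real.cosh (d x y) with hu
  have husymm : ∀ x y, u x y = u y x := fun x y => by simp only [hu, G.symm x y]; ring
  have scale : ∀ (x : Y) (ρ : ℝ), 0 ≤ ρ → ρ ≤ 1 → ∃ x',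
      Real.sinh (d p x') = ρ * Real.sinh (d p x) ∧ ∀ w, True → u x' w ≤ ρ * u x w ∧ True := by
    intro x ρ h0 h1
    have hL := G.nonneg p x
    rcases hL.eq_or_lt with hL | hL
    · refine ⟨x, by rw [← hL]; simp, fun w _ => ⟨?_, trivial⟩⟩
      have : u x w = 0 := by simp [hu, ← hL, G.congr_left hL.symm w]
      simp [this]
    · have hS : 0 < Real.sinh (d p x) := Real.sinh_pos_iff.2 hL
      set s := Real.arsinh (ρ * Real.sinh (d p x)) with hs
      have hsinh : Real.sinh s = ρ * Real.sinh (d p x) := Real.sinh_arsinh _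
      have hsL : s ≤ d p x := by
        rw [← Real.sinh_le_sinh, hsinh]
        exact mul_le_of_le_one_left hS.le h1
      obtain ⟨v, h2, h3⟩ := G.exists_between p x
        (Real.arsinh_nonneg_iff.2 (mul_nonneg h0 hS.le)) hsL
      refine ⟨v, by rw [h2, hsinh], fun w _ => ⟨?_, trivial⟩⟩
      have h4 := G.hyperbolic_between I h2 h3 (by ring) w
      rw [add_sub_cancel, Real.sinh_sub, ← hs, hsinh] at h4
      refine le_of_mul_le_mul_left ?_ hS
      simp only [hu, h2, ← hs]
      linarith
  obtain ⟨x', hx, hx'⟩ := scale x a ha ha'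
  obtain ⟨y', hy, hy'⟩ := scale y b hb hb'
  obtain ⟨z', hz, hz'⟩ := scale z c hc hc'
  have h1 := mul_scale_le husymm (R := fun _ _ => True) (fun _ _ h => h) hb hx' hy' trivial
  have h2 := mul_scale_le husymm (R := fun _ _ => True) (fun _ _ h => h) hc hy' hz' trivial
  have h3 := mul_scale_le husymm (R := fun _ _ => True) (fun _ _ h => h) ha hz' hx' trivial
  have h4 := I p x' y' z'
  have e1 := Real.cosh_sq (d p x')
  have e2 := Real.cosh_sq (d p y')
  have e3 := Real.cosh_sq (d p z')
  rw [form3, ← hx, ← hy, ← hz]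
  simp only [hu] at h1 h2 h3
  linarith

end

section

variable {Y : Type*} {d : Y → Y → ℝ}

/-! ### Positive lower curvature bound -/

/-- The contraction factor `1 / N` now depends on `w`. The bound `d z w + t < π` gives `cos t + cos
(d z w) > 0`, hence a uniform factor `1 / N₀ < 1` for all points no farther from `z` than the given
`w`. -/
lemma GeodesicDist.spherical_midpoint (G : GeodesicDist d)
    (I : ∀ p x y z, (Real.cos (d p x) + Real.cos (d p y) + Real.cos (d p z)) ^ 2 ≤
      3 + 2 * (Real.cos (d x y) + Real.cos (d y z) + Real.cos (d z x)))
    {x y z : Y} {t : ℝ} (ht : t < Real.pi / 2) (hx : d x z = t) (hy : d z y = t)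
    (hxy : d x y = 2 * t) {w : Y} (hw : d z w + t < Real.pi) :
    2 * Real.cos t * Real.cos (d z w) ≤ Real.cos (d x w) + Real.cos (d y w) := by
  have ht0 : 0 ≤ t := hx ▸ G.nonneg x z
  set R := d z w with hR
  have hR0 : 0 ≤ R := G.nonneg z w
  set T := Real.cos t with hT
  have hT0 : 0 < T := Real.cos_pos_of_mem_Ioo ⟨by linarith, ht⟩
  have h2t : Real.cos (2 * t) = 2 * T ^ 2 - 1 := Real.cos_two_mul t
  have hTR : 0 < T + Real.cos R := by
    have := Real.cos_lt_cos_of_nonneg_of_le_pi ht0 (by linarith) (show t < Real.pi - R by linarith)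
    rw [Real.cos_pi_sub] at this
    linarith
  have hTR' : 0 < 4 * T * (T + Real.cos R) := by positivity
  set N₀ := √(1 + 4 * T * (T + Real.cos R)) with hN₀
  have hN₀1 : 1 < N₀ := by
    rw [hN₀, Real.lt_sqrt zero_le_one]
    linarith
  have hN₀0 : 0 < N₀ := by linarith
  have key : ∀ (n : ℕ) (w : Y), d z w ≤ R → 2 * T * Real.cos (d z w) ≤
      Real.cos (d x w) + Real.cos (d y w) + (1 / N₀) ^ n * (1 / 2 * Real.sin (d z w) ^ 2) := by
    intro n
    induction n with
    | zero =>
      intro w _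
      have := I z x y w
      rw [G.symm z x, hx, hy, hxy, G.symm w x, h2t] at this
      rw [Real.sin_sq]
      linarith
    | succ n ih =>
      intro w hw
      have hs := G.nonneg z w
      set s := d z w
      set C := Real.cos s with hC
      set S := Real.sin s with hS
      have hS0 : 0 ≤ S := Real.sin_nonneg_of_nonneg_of_le_pi hs (by linarith)
      have hCS : S ^ 2 + C ^ 2 = 1 := Real.sin_sq_add_cos_sq s
      have hCR : Real.cos R ≤ C := Real.cos_le_cos_of_nonneg_of_le_pi hs (by linarith) hw
      set N := √(4 * T ^ 2 + 1 + 4 * T * C) with hN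
      have hCR' := mul_le_mul_of_nonneg_left hCR hT0.le
      have hN2 : N ^ 2 = 4 * T ^ 2 + 1 + 4 * T * C := Real.sq_sqrt (by linarith)
      have hN₀N : N₀ ≤ N := Real.sqrt_le_sqrt (by linarith)
      have hN0 : 0 < N := by linarith
      have hTC : 0 ≤ 2 * T + C := by linarith
      have hsq : ((2 * T + C) / N) ^ 2 + (S / N) ^ 2 = 1 := by
        rw [div_pow, div_pow, ← add_div, div_eq_one_iff_eq (by positivity), hN2]
        linear_combination hCS
      have hle1 : (2 * T + C) / N ≤ 1 := by
        refine (sq_le_one_iff₀ (by positivity)).1 ?_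
        linarith [sq_nonneg (S / N)]
      set s' := Real.arccos ((2 * T + C) / N) with hs'
      have hcos : Real.cos s' = (2 * T + C) / N :=
        Real.cos_arccos (by linarith [show 0 ≤ (2 * T + C) / N by positivity]) hle1
      have hsin : Real.sin s' = S / N := by
        rw [hs', Real.sin_arccos, ← Real.sqrt_sq (show 0 ≤ S / N by positivity)]
        congr 1
        linarith
      have hs'0 : 0 ≤ s' := Real.arccos_nonneg _
      have hs's : s' ≤ s := by
        rw [← Real.arccos_cos hs (by linarith)]
        refine Real.arccos_le_arccos ?_
        rw [le_div_iff₀ hN0]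
        rcases le_total C 0 with h | h
        · exact (mul_nonpos_of_nonpos_of_nonneg h hN0.le).trans hTC
        · have hC1 : C ≤ 1 := Real.cos_le_one s
          have hTC1 : T * C ≤ T := mul_le_of_le_one_right hT0.le hC1
          have : N ≤ 2 * T + 1 := Real.sqrt_le_iff.2 ⟨by linarith, by linarith⟩
          calc C * N ≤ C * (2 * T + 1) := by gcongr
            _ ≤ 2 * T + C := by linarith
      have hcos' : Real.cos (s - s') = (1 + 2 * T * C) / N := by
        rw [Real.cos_sub, hsin, hcos, ← hC, ← hS, ← mul_div_assoc, ← mul_div_assoc, ← add_div]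
        congr 1
        linear_combination hCS
      obtain ⟨v, h1, h2⟩ := G.exists_between z w hs'0 hs's
      have h3 := ih v (by rw [h1]; linarith)
      have h4 := I v x y w
      rw [h1, hcos, hsin] at h3
      rw [G.symm v x, G.symm v y, hxy, G.symm w x, h2, h2t, hcos'] at h4
      set K := (1 / N₀) ^ n with hK
      have hK0 : 0 < K := by positivity
      set E := K * (1 / 2 * (S / N) ^ 2) with hE
      have e1 : 2 * T * ((2 * T + C) / N) + (1 + 2 * T * C) / N = N := by
        rw [← mul_div_assoc, ← add_div, div_eq_iff hN0.ne']
        linear_combination -hN2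
      have h5 : N - E ≤ Real.cos (d x v) + Real.cos (d y v) + (1 + 2 * T * C) / N := by linarith
      set A := Real.cos (d x v) + Real.cos (d y v) + (1 + 2 * T * C) / N with hA
      -- The tangent-line bound `A ^ 2 ≥ 2 * N * A - N ^ 2` avoids a quadratic error and needs no
      -- sign of `A`.
      have h6 : N ^ 2 - 2 * N * E ≤ A ^ 2 := by
        have := mul_le_mul_of_nonneg_left h5 hN0.le
        linarith [sq_nonneg (A - N)]
      have e2 : 2 * N * E ≤ K * (1 / N₀) * S ^ 2 := by
        have : 2 * N * E = K * (1 / N) * S ^ 2 := by rw [hE]; field_simp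
        rw [this]
        gcongr
      rw [pow_succ (1 / N₀), ← hK]
      linarith
  refine le_of_forall_le_add_pow_mul (by positivity) ?_ fun n => key n w le_rfl
  rw [div_lt_one hN₀0]
  exact hN₀1

/-- The doubling argument contracts by `1 / (2 * cos a)`; shortness keeps this at most `2 / 3` and
leaves room for the midpoint comparison. -/
lemma GeodesicDist.spherical_between_of_short (G : GeodesicDist d)
    (I : ∀ p x y z, (Real.cos (d p x) + Real.cos (d p y) + Real.cos (d p z)) ^ 2 ≤
      3 + 2 * (Real.cos (d x y) + Real.cos (d y z) + Real.cos (d z x)))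
    {x y z : Y} {a b τ : ℝ} (hτ : τ ≤ 1) (hab : a + b ≤ τ) (hx : d x z = a) (hy : d z y = b)
    (hxy : d x y = a + b) {w : Y} (hxw : d x w + 2 * τ < Real.pi)
    (hyw : d y w + 2 * τ < Real.pi) :
    Real.sin (a + b) * Real.cos (d z w) ≤
      Real.sin b * Real.cos (d x w) + Real.sin a * Real.cos (d y w) := by
  have hpi := Real.pi_gt_three
  have key : ∀ (n : ℕ) (x y z : Y) (a b : ℝ), a + b ≤ τ → d x z = a → d z y = b →
      d x y = a + b → d x w + 2 * τ < Real.pi → d y w + 2 * τ < Real.pi →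
      Real.sin (a + b) * Real.cos (d z w) ≤
      Real.sin b * Real.cos (d x w) + Real.sin a * Real.cos (d y w) + (2 / 3 : ℝ) ^ n * 3 := by
    intro n
    induction n with
    | zero =>
      intro x y z a b _ _ _ _ _ _
      have bd : ∀ s c : ℝ, |Real.sin s * Real.cos c| ≤ 1 := fun s c => by
        rw [abs_mul]
        exact mul_le_one₀ (Real.abs_sin_le_one s) (abs_nonneg _) (Real.abs_cos_le_one c)
      have h1 := (abs_le.1 (bd (a + b) (d z w))).2
      have h2 := (abs_le.1 (bd b (d x w))).1
      have h3 := (abs_le.1 (bd a (d y w))).1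
      linarith
    | succ n ih =>
      intro x y z a b hL hx hy hxy hxw hyw
      wlog hab : a ≤ b generalizing x y z a b
      · have := this y x z b a (by linarith) (by rw [G.symm, hy]) (by rw [G.symm, hx])
          (by rw [G.symm, hxy]; ring) hyw hxw (by linarith)
        rw [add_comm b a] at this
        linarith
      have ha : 0 ≤ a := hx ▸ G.nonneg x z
      obtain ⟨v, h1, h2⟩ := G.exists_between z y ha (by rw [hy]; exact hab)
      rw [hy] at h2
      have hxv : d x v = 2 * a := by
        have h3 := G.triangle x z v
        have h4 := G.triangle x v y
        linarith
      have h5 := G.spherical_midpoint I (by linarith) hx h1 hxv (w := w) (by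
        have := G.triangle z x w
        rw [G.symm z x] at this
        linarith)
      have h6 := ih x y v (2 * a) (b - a) (by linarith) hxv h2 (by rw [hxy]; ring) hxw hyw
      rw [show 2 * a + (b - a) = a + b by ring] at h6
      have hL : 0 ≤ Real.sin (a + b) :=
        Real.sin_nonneg_of_nonneg_of_le_pi (by linarith) (by linarith)
      have h7 := mul_le_mul_of_nonneg_left h5 hL
      have e1 : Real.sin (a + b) + Real.sin (b - a) = 2 * Real.cos a * Real.sin b := by
        rw [Real.sin_add, Real.sin_sub]; ring
      have e2 : Real.sin (2 * a) = 2 * Real.cos a * Real.sin a := by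
        rw [Real.sin_two_mul]; ring
      have hA : 3 / 4 ≤ Real.cos a := by
        have := Real.one_sub_sq_div_two_le_cos (x := a)
        nlinarith
      set D := Real.sin (a + b) * Real.cos (d z w) -
        (Real.sin b * Real.cos (d x w) + Real.sin a * Real.cos (d y w)) with hD
      have hK : 0 < (2 / 3 : ℝ) ^ n * 3 := by positivity
      have h8 : 2 * Real.cos a * D ≤ (2 / 3 : ℝ) ^ n * 3 := by
        have e3 : 2 * Real.cos a * D = Real.sin (a + b) * (2 * Real.cos a * Real.cos (d z w)) -
          (2 * Real.cos a * Real.sin b) * Real.cos (d x w) -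
          (2 * Real.cos a * Real.sin a) * Real.cos (d y w) := by rw [hD]; ring
        rw [e3, ← e1, ← e2]
        linarith
      have h9 : 3 / 2 * D ≤ (2 / 3 : ℝ) ^ n * 3 := by
        rcases le_total D 0 with h | h
        · linarith
        · nlinarith
      rw [pow_succ (2 / 3 : ℝ)]
      linarith
  exact le_of_forall_le_add_pow_mul (by norm_num) (by norm_num)
    fun n => key n x y z a b hab hx hy hxy hxw hyw

/-- A discrete form of Sturm comparison: a function vanishing at `0` that is locally dominated by
the sinusoids through its values has nondecreasing quotient by the sine. -/
lemma sturm_comparison {u : ℝ → ℝ} {L τ : ℝ} (hL : L < Real.pi) (hτ : 0 < τ) (hu0 : u 0 = 0)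
    (hu : ∀ t a b : ℝ, 0 ≤ a → 0 ≤ b → 0 ≤ t → t + a + b ≤ L → a + b ≤ τ →
      Real.sin (a + b) * u (t + a) ≤ Real.sin b * u t + Real.sin a * u (t + a + b))
    {s : ℝ} (hs : 0 ≤ s) (hsL : s ≤ L) : u s * Real.sin L ≤ u L * Real.sin s := by
  set δ := min (τ / 2) 1 with hδ
  have hδ0 : 0 < δ := by positivity
  have hδτ : δ ≤ τ / 2 := min_le_left _ _
  have hδ1 : δ ≤ 1 := min_le_right _ _
  have hpi := Real.pi_gt_three
  have hsinδ : 0 < Real.sin δ := Real.sin_pos_of_pos_of_lt_pi hδ0 (by linarith)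
  have pos : ∀ r : ℝ, 0 < r → r ≤ L → 0 < Real.sin r := fun r h1 h2 =>
    Real.sin_pos_of_pos_of_lt_pi h1 (by linarith)
  have step : ∀ (n : ℕ) (s b : ℝ), 0 < s → 0 ≤ b → b ≤ δ → s + b ≤ L → s ≤ n * δ →
      u s * Real.sin (s + b) ≤ u (s + b) * Real.sin s := by
    intro n
    induction n with
    | zero =>
      intro s b h1 _ _ _ h2
      simp at h2
      linarith
    | succ n ih =>
      intro s b hs hb hbδ hsb hn
      rcases le_total s δ with h | h
      · have := hu 0 s b hs.le hb le_rfl (by linarith) (by linarith)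
        rw [hu0, zero_add] at this
        linarith
      rcases h.eq_or_lt with rfl | h
      · have := hu 0 δ b hs.le hb le_rfl (by linarith) (by linarith)
        rw [hu0, zero_add] at this
        linarith
      have h1 := ih (s - δ) δ (by linarith) hδ0.le le_rfl (by linarith) (by
        push_cast at hn
        linarith)
      rw [sub_add_cancel] at h1
      have h2 := hu (s - δ) δ b hδ0.le hb (by linarith) (by linarith) (by linarith)
      rw [sub_add_cancel] at h2
      have hsinb : 0 ≤ Real.sin b := Real.sin_nonneg_of_nonneg_of_le_pi hb (by linarith)
      have h3 := mul_le_mul_of_nonneg_left h1 hsinb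
      have h4 := mul_le_mul_of_nonneg_left h2 (pos s hs (by linarith)).le
      refine le_of_mul_le_mul_left ?_ hsinδ
      -- Inserting the bound on `u (s - δ)` from the previous step into the local inequality leaves
      -- this coefficient of `u s`.
      have e : Real.sin (δ + b) * Real.sin s - Real.sin b * Real.sin (s - δ) =
          Real.sin δ * Real.sin (s + b) := by
        rw [Real.sin_add, Real.sin_sub, Real.sin_add]; ring
      have e' : Real.sin δ * (u s * Real.sin (s + b)) =
        u s * (Real.sin (δ + b) * Real.sin s - Real.sin b * Real.sin (s - δ)) := by rw [e]; ring
      rw [e']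
      linarith
  have quot : ∀ s b : ℝ, 0 < s → 0 ≤ b → b ≤ δ → s + b ≤ L →
      u s / Real.sin s ≤ u (s + b) / Real.sin (s + b) := by
    intro s b hs hb hbδ hsb
    obtain ⟨n, hn⟩ := exists_nat_ge (s / δ)
    rw [div_le_div_iff₀ (pos s hs (by linarith)) (pos _ (by linarith) hsb)]
    exact step n s b hs hb hbδ hsb (by rwa [div_le_iff₀ hδ0] at hn)
  have chain : ∀ (n : ℕ) (s b : ℝ), 0 < s → 0 ≤ b → b ≤ n * δ → s + b ≤ L →
      u s / Real.sin s ≤ u (s + b) / Real.sin (s + b) := by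
    intro n
    induction n with
    | zero =>
      intro s b hs hb hbn hsb
      simp at hbn
      have : b = 0 := le_antisymm hbn hb
      simp [this]
    | succ n ih =>
      intro s b hs hb hbn hsb
      rcases le_total b δ with h | h
      · exact quot s b hs hb h hsb
      · refine (quot s δ hs hδ0.le le_rfl (by linarith)).trans ?_
        have := ih (s + δ) (b - δ) (by linarith) (by linarith) (by
          push_cast at hbn
          linarith) (by linarith)
        rwa [show s + δ + (b - δ) = s + b by ring] at this
  rcases hs.eq_or_lt with rfl | hs
  · simp [hu0]
  obtain ⟨n, hn⟩ := exists_nat_ge ((L - s) / δ)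
  have := chain n s (L - s) hs (by linarith) (by rwa [div_le_iff₀ hδ0] at hn) (by linarith)
  rw [add_sub_cancel, div_le_div_iff₀ (pos s hs hsL) (pos L (by linarith) le_rfl)] at this
  exact this

/-- Subtracting `cos t * cos (d p w)`, an exact sinusoid, from the cosine of the distance to `w`
gives a function vanishing at `p`, to which the Sturm comparison applies along the whole side. -/
lemma GeodesicDist.spherical_side (G : GeodesicDist d)
    (I : ∀ p x y z, (Real.cos (d p x) + Real.cos (d p y) + Real.cos (d p z)) ^ 2 ≤
      3 + 2 * (Real.cos (d x y) + Real.cos (d y z) + Real.cos (d z x)))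
    {p x : Y} (hL : d p x < Real.pi) {s : ℝ} (hs : 0 ≤ s) (hsL : s ≤ d p x) :
    ∃ v, d p v = s ∧ d v x = d p x - s ∧
      ∀ w, d p x + d p w + d x w < 2 * Real.pi →
        (Real.cos (d v w) - Real.cos s * Real.cos (d p w)) * Real.sin (d p x) ≤
          (Real.cos (d x w) - Real.cos (d p x) * Real.cos (d p w)) * Real.sin s := by
  obtain ⟨γ, hγ⟩ := G.geodesic p x
  refine ⟨γ s, (hγ s ⟨hs, hsL⟩).1, (hγ s ⟨hs, hsL⟩).2.1, fun w hw => ?_⟩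
  set L := d p x with hLdef
  have hL0 : 0 ≤ L := G.nonneg p x
  have d0 : ∀ v, d (γ 0) v = d p v := fun v =>
    (G.congr_left (hγ 0 ⟨le_rfl, hL0⟩).1 v).symm
  have dL : ∀ v, d (γ L) v = d x v := fun v =>
    G.congr_left (by rw [(hγ L ⟨hL0, le_rfl⟩).2.1, sub_self]) v
  set P := L + d p w + d x w with hP
  -- Every point of the side lies within half the perimeter of `w`, which is less than `π`; `τ` uses
  -- up part of the gap.
  obtain ⟨τ, hτ0, hτ1, hτP⟩ : ∃ τ : ℝ, 0 < τ ∧ τ ≤ 1 ∧ P / 2 + 2 * τ < Real.pi :=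
    ⟨min 1 ((Real.pi - P / 2) / 3), lt_min one_pos (by linarith), min_le_left _ _, by
      have := min_le_right 1 ((Real.pi - P / 2) / 3)
      linarith⟩
  have far : ∀ t, 0 ≤ t → t ≤ L → d (γ t) w + 2 * τ < Real.pi := by
    intro t h0 h1
    obtain ⟨h2, h3, -⟩ := hγ t ⟨h0, h1⟩
    have h4 := G.triangle (γ t) p w
    have h5 := G.triangle (γ t) x w
    rw [G.symm (γ t) p] at h4
    linarith
  have := sturm_comparison (u := fun t => Real.cos (d (γ t) w) - Real.cos t * Real.cos (d p w))
    hL hτ0 (by simp [d0]) (by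
      intro t a b ha hb ht htL hab
      have m1 : t ∈ Set.Icc 0 L := ⟨ht, by linarith⟩
      have m2 : t + a ∈ Set.Icc 0 L := ⟨by linarith, by linarith⟩
      have m3 : t + a + b ∈ Set.Icc 0 L := ⟨by linarith, htL⟩
      have h := G.spherical_between_of_short I hτ1 hab (x := γ t) (z := γ (t + a))
        (y := γ (t + a + b)) (w := w)
        (by rw [(hγ _ m2).2.2 _ m1, abs_sub_comm, add_sub_cancel_left, abs_of_nonneg ha])
        (by rw [(hγ _ m3).2.2 _ m2, abs_sub_comm, add_sub_cancel_left, abs_of_nonneg hb])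
        (by rw [(hγ _ m3).2.2 _ m1, abs_sub_comm, add_assoc, add_sub_cancel_left,
              abs_of_nonneg (by linarith)])
        (far _ m1.1 m1.2) (far _ m3.1 m3.2)
      have e : Real.sin (a + b) * Real.cos (t + a) =
          Real.sin b * Real.cos t + Real.sin a * Real.cos (t + a + b) := by
        have h1 : Real.cos t = Real.cos (t + a) * Real.cos a + Real.sin (t + a) * Real.sin a := by
          rw [← Real.cos_sub, add_sub_cancel_right]
        rw [h1, Real.cos_add (t + a) b, Real.sin_add a b]
        ring
      have e' := congrArg (· * Real.cos (d p w)) e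
      linarith) hs hsL
  rwa [dL] at this

lemma exists_sin_eq_mul_sin {L ρ : ℝ} (hL : 0 ≤ L) (hL' : L ≤ Real.pi) (h0 : 0 ≤ ρ)
    (h1 : ρ ≤ 1) : ∃ s, 0 ≤ s ∧ s ≤ L ∧ s ≤ Real.pi / 2 ∧ Real.sin s = ρ * Real.sin L := by
  have hS := Real.sin_nonneg_of_nonneg_of_le_pi hL hL'
  have h2 : ρ * Real.sin L ≤ Real.sin L := mul_le_of_le_one_left hS h1
  have h3 : 0 ≤ ρ * Real.sin L := mul_nonneg h0 hS
  refine ⟨Real.arcsin (ρ * Real.sin L), Real.arcsin_nonneg.2 h3, ?_, Real.arcsin_le_pi_div_two _,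
    Real.sin_arcsin (by linarith) (h2.trans (Real.sin_le_one L))⟩
  rcases le_total L (Real.pi / 2) with h | h
  · exact (Real.arcsin_le_arcsin h2).trans_eq (Real.arcsin_sin (by linarith) h)
  · exact (Real.arcsin_le_pi_div_two _).trans h

lemma GeodesicDist.spherical_weighted (G : GeodesicDist d)
    (I : ∀ p x y z, (Real.cos (d p x) + Real.cos (d p y) + Real.cos (d p z)) ^ 2 ≤
      3 + 2 * (Real.cos (d x y) + Real.cos (d y z) + Real.cos (d z x)))
    {p x y z : Y} (hxy : d p x + d p y + d x y < 2 * Real.pi)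
    (hyz : d p y + d p z + d y z < 2 * Real.pi) (hzx : d p z + d p x + d z x < 2 * Real.pi)
    {a b c : ℝ} (ha : 0 ≤ a) (hb : 0 ≤ b) (hc : 0 ≤ c) :
    0 ≤ form3 (Real.sin (d p x)) (Real.sin (d p y)) (Real.sin (d p z))
      (Real.cos (d x y) - Real.cos (d p x) * Real.cos (d p y))
      (Real.cos (d y z) - Real.cos (d p y) * Real.cos (d p z))
      (Real.cos (d z x) - Real.cos (d p z) * Real.cos (d p x)) a b c := by
  refine form3_nonneg_of_le_one ?_ ha hb hc
  intro a b c ha ha' hb hb' hc hc'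
  set u : Y → Y → ℝ := fun x y => Real.cos (d x y) - Real.cos (d p x) * Real.cos (d p y) with hu
  have husymm : ∀ x y, u x y = u y x := fun x y => by simp only [hu, G.symm x y]; ring
  -- Sliding a point towards `p` along a shortest path does not increase the perimeter, so `R` is
  -- preserved.
  set R : Y → Y → Prop := fun x y => d p x + d p y + d x y < 2 * Real.pi with hR
  have hRsymm : ∀ x y, R x y → R y x := fun x y h => by
    simp only [hR] at h ⊢
    rw [G.symm y x]
    linarith
  have scale : ∀ (x : Y) (ρ : ℝ), d p x < Real.pi → 0 ≤ ρ → ρ ≤ 1 → ∃ x',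
      Real.sin (d p x') = ρ * Real.sin (d p x) ∧ ∀ w, R x w → u x' w ≤ ρ * u x w ∧ R x' w := by
    intro x ρ hlt h0 h1
    have hL := G.nonneg p x
    rcases hL.eq_or_lt with hL | hL
    · refine ⟨x, by rw [← hL]; simp, fun w hw => ⟨?_, hw⟩⟩
      have : u x w = 0 := by simp [hu, ← hL, G.congr_left hL.symm w]
      simp [this]
    · have hS : 0 < Real.sin (d p x) := Real.sin_pos_of_pos_of_lt_pi hL hlt
      obtain ⟨s, hs0, hsL, -, hsin⟩ := exists_sin_eq_mul_sin hL.le hlt.le h0 h1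
      obtain ⟨v, h2, h3, h4⟩ := G.spherical_side I hlt hs0 hsL
      refine ⟨v, by rw [h2, hsin], fun w hw => ⟨?_, ?_⟩⟩
      · have h5 := h4 w hw
        rw [hsin] at h5
        refine le_of_mul_le_mul_left ?_ hS
        simp only [hu, h2]
        linarith
      · have h5 := G.triangle v x w
        simp only [hR] at hw ⊢
        linarith
  have lt_pi : ∀ x y, R x y → d p x < Real.pi := fun x y h => by
    have := G.triangle p y x
    rw [G.symm y x] at this
    simp only [hR] at h
    linarith
  obtain ⟨x', hx, hx'⟩ := scale x a (lt_pi x y hxy) ha ha'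
  obtain ⟨y', hy, hy'⟩ := scale y b (lt_pi y z hyz) hb hb'
  obtain ⟨z', hz, hz'⟩ := scale z c (lt_pi z x hzx) hc hc'
  have h1 := mul_scale_le husymm hRsymm hb hx' hy' hxy
  have h2 := mul_scale_le husymm hRsymm hc hy' hz' hyz
  have h3 := mul_scale_le husymm hRsymm ha hz' hx' hzx
  have h4 := I p x' y' z'
  have e1 := Real.sin_sq_add_cos_sq (d p x')
  have e2 := Real.sin_sq_add_cos_sq (d p y')
  have e3 := Real.sin_sq_add_cos_sq (d p z')
  rw [form3, ← hx, ← hy, ← hz]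
  simp only [hu] at h1 h2 h3
  linarith

end

/-! ### Positive curvature, the converse: perimeters in diameter at most `π` -/

lemma abs_cos_sub_le {a b c : ℝ} (hab : a ≤ b + c) (hba : b ≤ a + c) (hc : c ≤ a + b) (h : a + b + c ≤ 2 * Real.pi) :
    |Real.cos c - Real.cos a * Real.cos b| ≤ Real.sin a * Real.sin b := by
  have h1 : Real.cos c ≤ Real.cos (a - b) := by
    rw [← Real.cos_abs (a - b)]
    exact Real.cos_le_cos_of_nonneg_of_le_pi (abs_nonneg _) (by linarith)
      (abs_le.2 ⟨by linarith, by linarith⟩)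
  have h2 : Real.cos (a + b) ≤ Real.cos c := by
    rcases le_total (a + b) Real.pi with h' | h'
    · exact Real.cos_le_cos_of_nonneg_of_le_pi (by linarith) h' hc
    · rw [← Real.cos_two_pi_sub]
      exact Real.cos_le_cos_of_nonneg_of_le_pi (by linarith) (by linarith) (by linarith)
  rw [Real.cos_sub] at h1
  rw [Real.cos_add] at h2
  exact abs_le.2 ⟨by linarith, by linarith⟩

/-- The weighted form of the spherical quadruple comparison, for triples at the apex of perimeter
less than `2π`. -/
def SphericalWeighted {Y : Type*} (d : Y → Y → ℝ) : Prop :=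
  ∀ p x y z, d p x + d p y + d x y < 2 * Real.pi → d p y + d p z + d y z < 2 * Real.pi →
    d p z + d p x + d z x < 2 * Real.pi → ∀ a b c : ℝ, 0 ≤ a → 0 ≤ b → 0 ≤ c →
    0 ≤ form3 (Real.sin (d p x)) (Real.sin (d p y)) (Real.sin (d p z))
      (Real.cos (d x y) - Real.cos (d p x) * Real.cos (d p y))
      (Real.cos (d y z) - Real.cos (d p y) * Real.cos (d p z))
      (Real.cos (d z x) - Real.cos (d p z) * Real.cos (d p x)) a b c

section

variable {Y : Type*} {d : Y → Y → ℝ}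

/-- With apex `z` inside the segment, `x` and `y` lie in opposite directions, so weights `sin b` and
`sin a` cancel their part of the form. Taking the supposed defect `K > 0` as weight of `w` makes the
form at most `-K ^ 2`. -/
lemma SphericalWeighted.between (W : SphericalWeighted d) (G : GeodesicDist d)
    {x y z w : Y} {a b : ℝ} (hx : d x z = a) (hy : d z y = b) (hxy : d x y = a + b)
    (hab : a + b < Real.pi) (hw : d x w + d y w + (a + b) < 2 * Real.pi) :
    Real.sin (a + b) * Real.cos (d z w) ≤
      Real.sin b * Real.cos (d x w) + Real.sin a * Real.cos (d y w) := by
  have ha : 0 ≤ a := hx ▸ G.nonneg x z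
  have hb : 0 ≤ b := hy ▸ G.nonneg z y
  have hsa : 0 ≤ Real.sin a := Real.sin_nonneg_of_nonneg_of_le_pi ha (by linarith)
  have hsb : 0 ≤ Real.sin b := Real.sin_nonneg_of_nonneg_of_le_pi hb (by linarith)
  rw [G.symm] at hx
  have h1 := G.triangle z x w
  have h2 := G.triangle z y w
  by_contra! hlt
  obtain ⟨K, hK⟩ : ∃ K, K = Real.sin (a + b) * Real.cos (d z w) -
    (Real.sin b * Real.cos (d x w) + Real.sin a * Real.cos (d y w)) := ⟨_, rfl⟩
  have hK0 : 0 < K := by linarith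
  have := W z x y w (by linarith) (by linarith) (by rw [G.symm w x]; linarith)
    _ _ K hsb hsa hK0.le
  rw [form3, hx, hy, hxy, G.symm w x, Real.cos_add] at this
  rw [Real.sin_add] at hK
  have hS : Real.sin (d z w) ^ 2 ≤ 1 := Real.sin_sq_le_one _
  have hKS : K ^ 2 * Real.sin (d z w) ^ 2 ≤ K ^ 2 := mul_le_of_le_one_right (sq_nonneg K) hS
  have e : (Real.sin b * Real.sin a) ^ 2 + (Real.sin a * Real.sin b) ^ 2 +
      (K * Real.sin (d z w)) ^ 2 + 2 * (Real.sin b * Real.sin a * (Real.cos a * Real.cos b -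
        Real.sin a * Real.sin b - Real.cos a * Real.cos b) + Real.sin a * K *
        (Real.cos (d y w) - Real.cos b * Real.cos (d z w)) + K * Real.sin b *
        (Real.cos (d x w) - Real.cos (d z w) * Real.cos a)) =
      K ^ 2 * Real.sin (d z w) ^ 2 - 2 * K ^ 2 := by
    linear_combination (2 * K) * hK
  rw [e] at this
  have : 0 < K ^ 2 := by positivity
  linarith

lemma GeodesicDist.continuousOn_dist (G : GeodesicDist d) (c : Y) {γ : ℝ → Y} {l : ℝ}
    (hγ : ∀ s ∈ Set.Icc 0 l, ∀ t ∈ Set.Icc 0 l, d (γ s) (γ t) = |s - t|) :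
    ContinuousOn (fun t => d (γ t) c) (Set.Icc 0 l) := by
  refine (LipschitzOnWith.of_dist_le_mul (K := 1) fun s hs t ht => ?_).continuousOn
  have h1 := G.triangle (γ s) (γ t) c
  have h2 := G.triangle (γ t) (γ s) c
  rw [hγ t ht s hs] at h2
  rw [hγ s hs t ht] at h1
  rw [abs_sub_comm] at h2
  rw [Real.dist_eq, Real.dist_eq, NNReal.coe_one, one_mul]
  exact abs_le.2 ⟨by linarith, by linarith⟩

/-- A model triangle of perimeter `2π` is a great circle and contains the antipode of `c`. The
comparison, valid while the perimeter is below `2π`, is carried by continuity to the first parameter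
`m` at which it reaches `2π`. -/
lemma SphericalWeighted.antipode (W : SphericalWeighted d) (G : GeodesicDist d)
    (hd : ∀ x y, d x y ≤ Real.pi) (c : Y) {γ : ℝ → Y} {l : ℝ} (hl0 : 0 ≤ l) (hl : l < Real.pi)
    (hγ : ∀ s ∈ Set.Icc 0 l, ∀ t ∈ Set.Icc 0 l, d (γ s) (γ t) = |s - t|)
    (hper : 2 * Real.pi ≤ d (γ 0) c + l + d (γ l) c) :
    Real.pi - d (γ 0) c ≤ l ∧ d (γ (Real.pi - d (γ 0) c)) c = Real.pi := by
  set A := d (γ 0) c with hA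
  have hg := G.continuousOn_dist c hγ
  have hf : ContinuousOn (fun t => A + t + d (γ t) c) (Set.Icc 0 l) :=
    (continuousOn_const.add continuousOn_id).add hg
  have hcomp : IsCompact (Set.Icc 0 l ∩ (fun t => A + t + d (γ t) c) ⁻¹' Set.Ici (2 * Real.pi)) :=
    isCompact_Icc.of_isClosed_subset
      (hf.preimage_isClosed_of_isClosed isClosed_Icc isClosed_Ici) Set.inter_subset_left
  obtain ⟨m, ⟨⟨hm0, hml⟩, hm⟩, hmin⟩ := hcomp.exists_isLeast ⟨l, ⟨hl0, le_rfl⟩, hper⟩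
  replace hm : 2 * Real.pi ≤ A + m + d (γ m) c := hm
  have hA1 : A ≤ Real.pi := hd _ _
  have hm1 := hd (γ m) c
  have hle : Real.pi - A ≤ m := by linarith
  refine ⟨hle.trans hml, le_antisymm (hd _ _) ?_⟩
  set r := Real.pi - A with hr
  rcases hle.eq_or_lt with h | h
  · rw [h]
    linarith
  have hr0 : 0 ≤ r := by linarith
  have hlt : ∀ t ∈ Set.Ioo r m, A + t + d (γ t) c < 2 * Real.pi := by
    intro t ht
    by_contra! h'
    exact absurd (hmin ⟨⟨by linarith [ht.1], by linarith [ht.2]⟩, h'⟩) (not_le.2 ht.2)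
  have hsub : closure (Set.Ioo r m) ⊆ Set.Icc 0 l := by
    rw [closure_Ioo h.ne]
    exact Set.Icc_subset_Icc hr0 hml
  have hmem : m ∈ closure (Set.Ioo r m) := by
    rw [closure_Ioo h.ne]
    exact ⟨h.le, le_rfl⟩
  have hm2 : A + m + d (γ m) c ≤ 2 * Real.pi :=
    le_on_closure (g := fun _ => 2 * Real.pi) (fun t ht => (hlt t ht).le) (hf.mono hsub)
      continuousOn_const hmem
  have hcmp : ∀ t ∈ Set.Ioo r m, Real.sin t * Real.cos (d (γ r) c) ≤
      Real.sin (t - r) * Real.cos A + Real.sin r * Real.cos (d (γ t) c) := by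
    intro t ht
    have h0 : (0 : ℝ) ∈ Set.Icc 0 l := ⟨le_rfl, hl0⟩
    have h1 : r ∈ Set.Icc 0 l := ⟨hr0, by linarith⟩
    have h2 : t ∈ Set.Icc 0 l := ⟨by linarith [ht.1], by linarith [ht.2]⟩
    have := W.between G (x := γ 0) (z := γ r) (y := γ t) (w := c) (a := r) (b := t - r)
      (by rw [hγ _ h0 _ h1, zero_sub, abs_neg, abs_of_nonneg hr0])
      (by rw [hγ _ h1 _ h2, abs_sub_comm, abs_of_nonneg (by linarith [ht.1])])
      (by rw [hγ _ h0 _ h2, zero_sub, abs_neg, abs_of_nonneg h2.1]; ring)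
      (by linarith [h2.2]) (by linarith [hlt t ht])
    rwa [add_sub_cancel, ← hA] at this
  have hlim := le_on_closure hcmp
    ((by fun_prop : ContinuousOn (fun t => Real.sin t * Real.cos (d (γ r) c)) _))
    (((by fun_prop : ContinuousOn (fun t => Real.sin (t - r) * Real.cos A) _)).add
      (continuousOn_const.mul (Real.continuous_cos.comp_continuousOn (hg.mono hsub)))) hmem
  have e : d (γ m) c = 2 * Real.pi - (A + m) := by linarith
  have e1 : m - r = A + m - Real.pi := by rw [hr]; ring
  have e2 : Real.sin m = Real.sin (A + m) * Real.cos A - Real.cos (A + m) * Real.sin A := by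
    rw [← Real.sin_sub, add_sub_cancel_left]
  rw [e, e1, Real.cos_two_pi_sub, hr, Real.sin_sub_pi, Real.sin_pi_sub, ← hr] at hlim
  have hsm : 0 < Real.sin m := Real.sin_pos_of_pos_of_lt_pi (by linarith) (by linarith)
  have hcos : Real.cos (d (γ r) c) ≤ -1 := by
    refine le_of_mul_le_mul_left ?_ hsm
    linarith
  by_contra! hlt'
  have := Real.cos_lt_cos_of_nonneg_of_le_pi (G.nonneg _ _) le_rfl hlt'
  rw [Real.cos_pi] at this
  linarith

/-- Compare with a point `v` at distance `ε` from `c` on a shortest path from `z`: as `x` and `y`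
are at least `π - ε` from `v`, comparison would give `sin a + sin b ≤ sin (a + b)`. Choosing `ε > a
+ b` keeps the perimeter below `2π`. -/
lemma SphericalWeighted.not_three_antipodes (W : SphericalWeighted d) (G : GeodesicDist d)
    {x y z c : Y} {a b : ℝ} (ha : 0 < a) (hb : 0 < b) (hx : d x z = a) (hy : d z y = b)
    (hxy : d x y = a + b) (hab : a + b < Real.pi / 2) (hcx : d x c = Real.pi)
    (hcy : d y c = Real.pi) (hcz : d z c = Real.pi) : False := by
  obtain ⟨ε, hε, hε'⟩ := exists_between hab
  obtain ⟨v, h1, h2⟩ := G.exists_between z c (t := Real.pi - ε) (by linarith) (by linarith)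
  have h3 := G.triangle x z v
  have h4 := G.triangle y z v
  have h5 := G.triangle x v c
  have h6 := G.triangle y v c
  rw [G.symm y z] at h4
  have h := W.between G hx hy hxy (by linarith) (w := v) (by linarith)
  have hsa : 0 < Real.sin a := Real.sin_pos_of_pos_of_lt_pi ha (by linarith)
  have hsb : 0 < Real.sin b := Real.sin_pos_of_pos_of_lt_pi hb (by linarith)
  have hce : 0 < Real.cos ε := Real.cos_pos_of_mem_Ioo ⟨by linarith, hε'⟩
  have hcos : ∀ q, Real.pi - ε ≤ q → q ≤ Real.pi → Real.cos q ≤ -Real.cos ε := fun q hq hq' => by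
    rw [← Real.cos_pi_sub]
    exact Real.cos_le_cos_of_nonneg_of_le_pi (by linarith) hq' hq
  have h7 := mul_le_mul_of_nonneg_left (hcos (d x v) (by linarith) (by linarith)) hsb.le
  have h8 := mul_le_mul_of_nonneg_left (hcos (d y v) (by linarith) (by linarith)) hsa.le
  rw [h1, Real.cos_pi_sub, Real.sin_add] at h
  have hca : Real.cos a < 1 := by
    rw [← Real.cos_zero]
    exact Real.cos_lt_cos_of_nonneg_of_le_pi le_rfl (by linarith) ha
  have h9 : Real.sin a + Real.sin b ≤ Real.sin a * Real.cos b + Real.cos a * Real.sin b := by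
    refine le_of_mul_le_mul_right ?_ hce
    linarith
  have h10 := mul_lt_mul_of_pos_right hca hsb
  have h11 := mul_le_mul_of_nonneg_left (Real.cos_le_one b) hsa.le
  linarith

lemma SphericalWeighted.not_two_antipodes (W : SphericalWeighted d) (G : GeodesicDist d)
    (hd : ∀ x y, d x y ≤ Real.pi) {c : Y} {γ : ℝ → Y} {l : ℝ} (hl0 : 0 < l)
    (hl : l < Real.pi / 2) (hγ : ∀ s ∈ Set.Icc 0 l, ∀ t ∈ Set.Icc 0 l, d (γ s) (γ t) = |s - t|)
    (h0 : d (γ 0) c = Real.pi) (h1 : d (γ l) c = Real.pi) : False := by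
  have m0 : (0 : ℝ) ∈ Set.Icc 0 l := ⟨le_rfl, hl0.le⟩
  have m1 : l ∈ Set.Icc 0 l := ⟨hl0.le, le_rfl⟩
  have mm : l / 2 ∈ Set.Icc 0 l := ⟨by linarith, by linarith⟩
  have d1 : d (γ 0) (γ (l / 2)) = l / 2 := by
    rw [hγ _ m0 _ mm, zero_sub, abs_neg, abs_of_nonneg mm.1]
  have d2 : d (γ (l / 2)) (γ l) = l / 2 := by
    rw [hγ _ mm _ m1, abs_sub_comm, abs_of_nonneg (by linarith)]; ring
  have d3 : d (γ 0) (γ l) = l / 2 + l / 2 := by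
    rw [hγ _ m0 _ m1, zero_sub, abs_neg, abs_of_nonneg hl0.le]; ring
  set q := d (γ (l / 2)) c with hq
  have hq1 : q ≤ Real.pi := hd _ _
  have hq2 : Real.pi ≤ l / 2 + q := by
    have := G.triangle (γ 0) (γ (l / 2)) c
    linarith
  -- If the midpoint is as close to `c` as possible, a point on its shortest path to `c` is at
  -- distance exactly `l` from both ends, violating comparison. Otherwise half the segment has
  -- perimeter above `2π` with `c` and contains a third antipode.
  rcases hq2.eq_or_lt with h | h
  · obtain ⟨v, e1, e2⟩ := G.exists_between (γ (l / 2)) c (t := l / 2) mm.1 (by linarith)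
    have h3 := G.triangle (γ 0) (γ (l / 2)) v
    have h4 := G.triangle (γ l) (γ (l / 2)) v
    have h5 := G.triangle (γ 0) v c
    have h6 := G.triangle (γ l) v c
    rw [G.symm (γ l) (γ (l / 2))] at h4
    have h7 : d (γ 0) v = l := by linarith
    have h8 : d (γ l) v = l := by linarith
    have h9 := W.between G d1 d2 d3 (by linarith) (w := v) (by linarith)
    rw [h7, h8, e1, ← two_mul, Real.sin_two_mul, ← add_halves l, ← two_mul,
      Real.cos_two_mul, show 2 * (l / 2) / 2 = l / 2 by ring] at h9
    have hs : 0 < Real.sin (l / 2) := Real.sin_pos_of_pos_of_lt_pi (by linarith) (by linarith)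
    have hc : Real.cos (l / 2) ^ 2 < 1 := by
      have := Real.sin_sq_add_cos_sq (l / 2)
      have : 0 < Real.sin (l / 2) ^ 2 := by positivity
      linarith
    have h10 : Real.cos (l / 2) ^ 2 ≤ 2 * Real.cos (l / 2) ^ 2 - 1 := by
      refine le_of_mul_le_mul_left ?_ hs
      linarith
    linarith
  · have hsh : ∀ s ∈ Set.Icc 0 (l / 2), l / 2 + s ∈ Set.Icc 0 l := fun s hs =>
      ⟨by linarith [hs.1], by linarith [hs.2]⟩
    have hant := W.antipode G hd c (γ := fun t => γ (l / 2 + t)) mm.1 (by linarith)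
      (fun s hs t ht => by rw [hγ _ (hsh s hs) _ (hsh t ht), add_sub_add_left_eq_sub]) (by
        rw [add_zero, add_halves, h1, ← hq]
        linarith)
    rw [add_zero, ← hq] at hant
    set r := l / 2 + (Real.pi - q) with hr
    have mr : r ∈ Set.Icc 0 l := ⟨by linarith, by linarith⟩
    exact W.not_three_antipodes G (x := γ 0) (y := γ l) (z := γ r) (c := c) (a := r) (b := l - r)
      (by linarith) (by linarith)
      (by rw [hγ _ m0 _ mr, zero_sub, abs_neg, abs_of_nonneg mr.1])
      (by rw [hγ _ mr _ m1, abs_sub_comm, abs_of_nonneg (by linarith)])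
      (by linarith) (by linarith) h0 h1 hant.2

/-- Shorten the side until the perimeter is `2π + η`. The antipode found from either end lies at a
different place, and the two are `η` apart, which is impossible. -/
lemma SphericalWeighted.perimeter_le (W : SphericalWeighted d) (G : GeodesicDist d)
    (hd : ∀ x y, d x y ≤ Real.pi) (x y c : Y) : d x c + d x y + d y c ≤ 2 * Real.pi := by
  by_contra! hlt
  have hpi := Real.pi_gt_three
  obtain ⟨γ, hγ⟩ := G.geodesic x y
  set l := d x y with hl
  have hl0 : 0 ≤ l := G.nonneg x y
  have hiso : ∀ s ∈ Set.Icc 0 l, ∀ t ∈ Set.Icc 0 l, d (γ s) (γ t) = |s - t| :=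
    fun s hs t ht => (hγ t ht).2.2 s hs
  have d0 : d (γ 0) c = d x c := (G.congr_left (hγ 0 ⟨le_rfl, hl0⟩).1 c).symm
  have dl : d (γ l) c = d y c :=
    G.congr_left (by rw [(hγ l ⟨hl0, le_rfl⟩).2.1, sub_self]) c
  set η := min ((d x c + l + d y c - 2 * Real.pi) / 2) 1 with hη
  have hη0 : 0 < η := lt_min (by linarith) one_pos
  have hη1 : η ≤ 1 := min_le_right _ _
  have hη2 : η ≤ (d x c + l + d y c - 2 * Real.pi) / 2 := min_le_left _ _
  have hg := G.continuousOn_dist c hiso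
  have hf : ContinuousOn (fun t => d x c + t + d (γ t) c) (Set.Icc 0 l) :=
    (continuousOn_const.add continuousOn_id).add hg
  obtain ⟨m, ⟨hm0, hml⟩, hm⟩ := intermediate_value_Icc hl0 hf
    (show 2 * Real.pi + η ∈ Set.Icc _ _ from
      ⟨by linarith [hd x c], by linarith⟩)
  dsimp only at hm
  have hml' : m < l := by
    refine lt_of_le_of_ne hml ?_
    rintro rfl
    linarith
  have hmpi : m < Real.pi := hml'.trans_le (hd x y)
  have hiso' : ∀ s ∈ Set.Icc 0 m, ∀ t ∈ Set.Icc 0 m, d (γ s) (γ t) = |s - t| :=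
    fun s hs t ht => hiso s ⟨hs.1, hs.2.trans hml⟩ t ⟨ht.1, ht.2.trans hml⟩
  obtain ⟨-, h2⟩ := W.antipode G hd c hm0 hmpi hiso' (by linarith)
  obtain ⟨-, h4⟩ := W.antipode G hd c (γ := fun t => γ (m - t)) hm0 hmpi
    (fun s hs t ht => by
      rw [hiso' _ ⟨by linarith [hs.2], by linarith [hs.1]⟩ _
        ⟨by linarith [ht.2], by linarith [ht.1]⟩, sub_sub_sub_cancel_left, abs_sub_comm])
    (by rw [sub_zero, sub_self]; linarith)
  rw [sub_zero] at h4
  have hA := hd x c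
  have hB := hd (γ m) c
  refine W.not_two_antipodes G hd (c := c) (γ := fun t => γ (Real.pi - d (γ 0) c + t)) hη0
    (by linarith) (fun s hs t ht => ?_) (by rw [add_zero, h2]) ?_
  · rw [hiso' _ ⟨by linarith [hs.1], by linarith [hs.2]⟩ _
      ⟨by linarith [ht.1], by linarith [ht.2]⟩, add_sub_add_left_eq_sub]
  · rw [← h4]
    congr 2
    linarith

/-- At perimeter exactly `2π` the side passes through an antipode of `w`. The condition `s ≤ π - d p
w` puts `v` before it, where the distance to `w` grows at unit speed and equality holds. -/
lemma SphericalWeighted.side (W : SphericalWeighted d) (G : GeodesicDist d)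
    (hd : ∀ x y, d x y ≤ Real.pi) {p x : Y} (hL : d p x < Real.pi) {s : ℝ} (hs : 0 ≤ s)
    (hsL : s ≤ d p x) : ∃ v, d p v = s ∧ ∀ w, s ≤ Real.pi - d p w →
        (Real.cos (d v w) - Real.cos s * Real.cos (d p w)) * Real.sin (d p x) ≤
          (Real.cos (d x w) - Real.cos (d p x) * Real.cos (d p w)) * Real.sin s := by
  obtain ⟨γ, hγ⟩ := G.geodesic p x
  obtain ⟨h1, h2, -⟩ := hγ s ⟨hs, hsL⟩
  refine ⟨γ s, h1, fun w hsw => ?_⟩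
  set L := d p x with hLdef
  have hL0 : 0 ≤ L := G.nonneg p x
  rcases (W.perimeter_le G hd p x w).eq_or_lt with h | h
  · have d0 : d (γ 0) w = d p w := (G.congr_left (hγ 0 ⟨le_rfl, hL0⟩).1 w).symm
    have dL : d (γ L) w = d x w :=
      G.congr_left (by rw [(hγ L ⟨hL0, le_rfl⟩).2.1, sub_self]) w
    obtain ⟨h3, h4⟩ := W.antipode G hd w hL0 hL (fun s hs t ht => (hγ t ht).2.2 s hs)
      (by rw [d0, dL]; exact h.ge)
    rw [d0] at h3 h4
    have h5 : d (γ s) w = s + d p w := by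
      have t1 := G.triangle (γ s) p w
      have t2 := G.triangle (γ (Real.pi - d p w)) (γ s) w
      rw [(hγ s ⟨hs, hsL⟩).2.2 _ ⟨by linarith, h3⟩, abs_of_nonneg (by linarith), h4] at t2
      rw [G.symm (γ s) p] at t1
      linarith
    have h6 : d x w = 2 * Real.pi - (L + d p w) := by linarith
    rw [h5, h6, Real.cos_two_pi_sub, Real.cos_add, Real.cos_add]
    linarith
  · have h3 := W.between G h1 h2 (by ring) (by linarith) (w := w) (by linarith)
    rw [add_sub_cancel, Real.sin_sub] at h3
    linarith

/-- In a space of diameter at most `π` the weighted comparison for triples of perimeter less than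
`2π` implies the quadruple inequality without restriction. -/
lemma SphericalWeighted.form3_nonneg (W : SphericalWeighted d) (G : GeodesicDist d)
    (hd : ∀ x y, d x y ≤ Real.pi) (p x y z : Y) :
    0 ≤ form3 (Real.sin (d p x)) (Real.sin (d p y)) (Real.sin (d p z))
      (Real.cos (d x y) - Real.cos (d p x) * Real.cos (d p y))
      (Real.cos (d y z) - Real.cos (d p y) * Real.cos (d p z))
      (Real.cos (d z x) - Real.cos (d p z) * Real.cos (d p x)) 1 1 1 := by
  have hsin : ∀ q, 0 ≤ Real.sin (d p q) := fun q =>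
    Real.sin_nonneg_of_nonneg_of_le_pi (G.nonneg _ _) (hd _ _)
  have hbd : ∀ q r, |Real.cos (d q r) - Real.cos (d p q) * Real.cos (d p r)| ≤
      Real.sin (d p q) * Real.sin (d p r) := fun q r => by
    have h1 := G.triangle p r q
    have h2 := G.triangle p q r
    have h3 := G.triangle q p r
    have h4 := W.perimeter_le G hd p q r
    rw [G.symm r q] at h1
    rw [G.symm q p] at h3
    exact abs_cos_sub_le (by linarith) (by linarith) (by linarith) (by linarith)
  refine form3_nonneg_of_pos_imp (hsin x) (hsin y) (hsin z) (hbd x y) (hbd y z) (hbd z x)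
    zero_le_one zero_le_one zero_le_one fun px py pz => ?_
  have hlt : ∀ q, 0 < Real.sin (d p q) → d p q < Real.pi := fun q hq => by
    refine lt_of_le_of_ne (hd p q) fun h => ?_
    rw [h, Real.sin_pi] at hq
    exact lt_irrefl _ hq
  have hx := hlt x px
  have hy := hlt y py
  have hz := hlt z pz
  obtain ⟨m, hm0, hm1, hmx, hmy, hmz⟩ : ∃ m : ℝ, 0 < m ∧ m ≤ 1 ∧ d p x ≤ Real.pi - m ∧
      d p y ≤ Real.pi - m ∧ d p z ≤ Real.pi - m := by
    refine ⟨min (min 1 (Real.pi - d p x)) (min (Real.pi - d p y) (Real.pi - d p z)),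
      lt_min (lt_min one_pos (by linarith)) (lt_min (by linarith) (by linarith)),
      (min_le_left _ _).trans (min_le_left _ _), ?_, ?_, ?_⟩
    · linarith [(min_le_left (min 1 (Real.pi - d p x))
        (min (Real.pi - d p y) (Real.pi - d p z))).trans (min_le_right _ _)]
    · linarith [(min_le_right (min 1 (Real.pi - d p x))
        (min (Real.pi - d p y) (Real.pi - d p z))).trans (min_le_left _ _)]
    · linarith [(min_le_right (min 1 (Real.pi - d p x))
        (min (Real.pi - d p y) (Real.pi - d p z))).trans (min_le_right _ _)]
  have hpi := Real.pi_gt_three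
  -- One common factor suffices because the weights are equal. It is small enough that every slid
  -- point is within `m` of `p`, as the side comparison requires, and within `1`, so all new
  -- perimeters are at most `4 < 2π`.
  set ρ := Real.sin m with hρ
  have hρ0 : 0 < ρ := Real.sin_pos_of_pos_of_lt_pi hm0 (by linarith)
  set u : Y → Y → ℝ := fun x y => Real.cos (d x y) - Real.cos (d p x) * Real.cos (d p y) with hu
  have husymm : ∀ x y, u x y = u y x := fun x y => by simp only [hu, G.symm x y]; ring
  set R : Y → Y → Prop := fun x y => d p x ≤ Real.pi - m ∧ d p y ≤ Real.pi - m with hR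
  have scale : ∀ x : Y, 0 < Real.sin (d p x) → d p x ≤ Real.pi - m → ∃ x',
      Real.sin (d p x') = ρ * Real.sin (d p x) ∧ d p x' ≤ 1 ∧
        ∀ w, R x w → u x' w ≤ ρ * u x w ∧ R x' w := by
    intro x hS hx
    have hx' : d p x < Real.pi := by linarith
    obtain ⟨s, hs0, hsL, hs2, hs⟩ :=
      exists_sin_eq_mul_sin (G.nonneg p x) hx'.le hρ0.le (Real.sin_le_one m)
    have hsm : s ≤ m := by
      by_contra! h
      have h1 := Real.sin_lt_sin_of_lt_of_le_pi_div_two (by linarith) hs2 h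
      have h2 := mul_le_of_le_one_right hρ0.le (Real.sin_le_one (d p x))
      linarith
    obtain ⟨v, h1, h2⟩ := W.side G hd hx' hs0 hsL
    refine ⟨v, by rw [h1, hs], by linarith, fun w hw => ⟨?_, by rw [h1]; linarith, hw.2⟩⟩
    have h3 := h2 w (by linarith [hw.2])
    rw [hs] at h3
    refine le_of_mul_le_mul_left ?_ hS
    simp only [hu, h1]
    linarith
  obtain ⟨x', hx1, hx2, hx3⟩ := scale x px hmx
  obtain ⟨y', hy1, hy2, hy3⟩ := scale y py hmy
  obtain ⟨z', hz1, hz2, hz3⟩ := scale z pz hmz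
  have hRs : ∀ x y, R x y → R y x := fun _ _ h => ⟨h.2, h.1⟩
  have h1 := mul_scale_le husymm hRs hρ0.le hx3 hy3 ⟨hmx, hmy⟩
  have h2 := mul_scale_le husymm hRs hρ0.le hy3 hz3 ⟨hmy, hmz⟩
  have h3 := mul_scale_le husymm hRs hρ0.le hz3 hx3 ⟨hmz, hmx⟩
  have per : ∀ q r, d p q ≤ 1 → d p r ≤ 1 → d p q + d p r + d q r < 2 * Real.pi := by
    intro q r hq hr
    have := G.triangle q p r
    rw [G.symm q p] at this
    linarith
  have h4 := W p x' y' z' (per _ _ hx2 hy2) (per _ _ hy2 hz2) (per _ _ hz2 hx2) 1 1 1 zero_le_one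
    zero_le_one zero_le_one
  rw [form3, hx1, hy1, hz1] at h4
  refine le_of_mul_le_mul_left ?_ (pow_pos hρ0 2)
  rw [form3]
  simp only [hu] at h1 h2 h3
  linarith

end

/-! ### Transfer to the metric space -/

lemma abs_euclidean_le {a b c : ℝ} (hab : a ≤ b + c) (hba : b ≤ a + c) (hc : c ≤ a + b) :
    |(a ^ 2 + b ^ 2 - c ^ 2) / 2| ≤ a * b := by
  have h0 : 0 ≤ c := by linarith
  rw [abs_le]
  constructor
  · nlinarith
  · nlinarith

lemma abs_cosh_sub_le {a b c : ℝ} (hab : a ≤ b + c) (hba : b ≤ a + c) (hc : c ≤ a + b) :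
    |Real.cosh a * Real.cosh b - Real.cosh c| ≤ Real.sinh a * Real.sinh b := by
  have h1 : Real.cosh (a - b) ≤ Real.cosh c := by
    rw [Real.cosh_le_cosh, abs_of_nonneg (show 0 ≤ c by linarith)]
    exact abs_le.2 ⟨by linarith, by linarith⟩
  have h2 : Real.cosh c ≤ Real.cosh (a + b) := by
    rw [Real.cosh_le_cosh, abs_of_nonneg (show 0 ≤ c by linarith),
      abs_of_nonneg (show 0 ≤ a + b by linarith)]
    exact hc
  rw [Real.cosh_sub] at h1
  rw [Real.cosh_add] at h2
  exact abs_le.2 ⟨by linarith, by linarith⟩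

section

variable {X : Type*} [MetricSpace X]

lemma scaled_triangle {k : ℝ} (hk : 0 ≤ k) (p x y : X) :
    k * dist p x ≤ k * dist p y + k * dist x y ∧ k * dist p y ≤ k * dist p x + k * dist x y ∧
      k * dist x y ≤ k * dist p x + k * dist p y := by
  simp only [← mul_add]
  refine ⟨mul_le_mul_of_nonneg_left ?_ hk, mul_le_mul_of_nonneg_left (dist_triangle p x y) hk,
    mul_le_mul_of_nonneg_left (dist_triangle_left x y p) hk⟩
  rw [dist_comm x y]
  exact dist_triangle p y x

lemma hyperbolicInequality_iff (κ : ℝ) : HyperbolicInequality κ X ↔ ∀ p x y z : X,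
    3 + 2 * (Real.cosh (√(-κ) * dist x y) + Real.cosh (√(-κ) * dist y z) +
      Real.cosh (√(-κ) * dist z x)) ≤ (Real.cosh (√(-κ) * dist p x) +
      Real.cosh (√(-κ) * dist p y) + Real.cosh (√(-κ) * dist p z)) ^ 2 := by
  have e : ∀ (x y z : X), Real.cosh (√(-κ) * dist x x) + Real.cosh (√(-κ) * dist x y) +
      Real.cosh (√(-κ) * dist x z) + (Real.cosh (√(-κ) * dist y x) + Real.cosh (√(-κ) * dist y y) +
      Real.cosh (√(-κ) * dist y z)) + (Real.cosh (√(-κ) * dist z x) + Real.cosh (√(-κ) * dist z y) +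
      Real.cosh (√(-κ) * dist z z)) = 3 + 2 * (Real.cosh (√(-κ) * dist x y) +
        Real.cosh (√(-κ) * dist y z) + Real.cosh (√(-κ) * dist z x)) := fun x y z => by
    simp only [dist_self, mul_zero, Real.cosh_zero, dist_comm y x, dist_comm z y, dist_comm x z]
    ring
  refine ⟨fun h p x y z => ?_, fun h p x => ?_⟩
  · have := h p ![x, y, z]
    simp only [Fin.sum_univ_three, Matrix.cons_val] at this
    rwa [e] at this
  · simp only [Fin.sum_univ_three]
    rw [e]
    exact h p (x 0) (x 1) (x 2)

lemma sphericalInequality_iff (κ : ℝ) : SphericalInequality κ X ↔ ∀ p x y z : X,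
    (Real.cos (√κ * dist p x) + Real.cos (√κ * dist p y) + Real.cos (√κ * dist p z)) ^ 2 ≤
      3 + 2 * (Real.cos (√κ * dist x y) + Real.cos (√κ * dist y z) + Real.cos (√κ * dist z x)) := by
  have e : ∀ (x y z : X), Real.cos (√κ * dist x x) + Real.cos (√κ * dist x y) +
      Real.cos (√κ * dist x z) + (Real.cos (√κ * dist y x) + Real.cos (√κ * dist y y) +
      Real.cos (√κ * dist y z)) + (Real.cos (√κ * dist z x) + Real.cos (√κ * dist z y) +
      Real.cos (√κ * dist z z)) = 3 + 2 * (Real.cos (√κ * dist x y) +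
        Real.cos (√κ * dist y z) + Real.cos (√κ * dist z x)) := fun x y z => by
    simp only [dist_self, mul_zero, Real.cos_zero, dist_comm y x, dist_comm z y, dist_comm x z]
    ring
  refine ⟨fun h p x y z => ?_, fun h p x => ?_⟩
  · have := h p ![x, y, z]
    simp only [Fin.sum_univ_three, Matrix.cons_val] at this
    rwa [e] at this
  · simp only [Fin.sum_univ_three]
    rw [e]
    exact h p (x 0) (x 1) (x 2)

/-! ### Curvature bounded below by zero -/

lemma angleAt_zero (p x y : X) : angleAt 0 p x y =
    Real.arccos ((dist p x ^ 2 + dist p y ^ 2 - dist x y ^ 2) / 2 / (dist p x * dist p y)) := by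
  simp only [angleAt, modelAngle, lt_irrefl, if_false, div_div, mul_assoc]

lemma isAlexandrovSpace_zero_of_inequality [CompleteSpace X] (hX : IsIntrinsic X)
    (h : EuclideanInequality X) : IsAlexandrovSpace 0 X := by
  refine ⟨inferInstance, hX, fun p x y z hxy hyz hzx => ?_⟩
  have G := geodesicDist_ultraDist hX one_pos
  have I : ∀ p x y z : BddSeq X, (1 / 3 : ℝ) * (ultraDist 1 x y ^ 2 + ultraDist 1 y z ^ 2 +
      ultraDist 1 z x ^ 2) ≤ ultraDist 1 p x ^ 2 + ultraDist 1 p y ^ 2 + ultraDist 1 p z ^ 2 := by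
    intro p x y z
    have T : ∀ u v : BddSeq X, Tendsto (fun n => dist (u.1 n) (v.1 n) ^ 2) (hyperfilter ℕ)
        (𝓝 (ultraDist 1 u v ^ 2)) := fun u v => by
      simpa only [one_mul] using (tendsto_ultraDist 1 u v).pow 2
    exact le_of_tendsto_of_tendsto' ((((T x y).add (T y z)).add (T z x)).const_mul _)
      (((T p x).add (T p y)).add (T p z)) fun n => h _ _ _ _
  have bd : ∀ q r : X, |(dist p q ^ 2 + dist p r ^ 2 - dist q r ^ 2) / 2| ≤ dist p q * dist p r :=
    fun q r => by
      obtain ⟨h1, h2, h3⟩ := scaled_triangle zero_le_one p q r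
      simp only [one_mul] at h1 h2 h3
      exact abs_euclidean_le h1 h2 h3
  simp only [angleAt_zero]
  refine arccos_add_le_of_form3_nonneg (dist_pos.2 hxy.1) (dist_pos.2 hyz.1) (dist_pos.2 hzx.1)
    (bd x y) (bd y z) (bd z x) fun a b c ha hb hc => ?_
  simpa only [ultraDist_const, one_mul] using G.euclidean_weighted I (BddSeq.const p)
    (BddSeq.const x) (BddSeq.const y) (BddSeq.const z) ha hb hc

lemma IsAlexandrovSpace.euclideanInequality (h : IsAlexandrovSpace 0 X) :
    EuclideanInequality X := by
  intro p x y z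
  have bd : ∀ q r : X, |(dist p q ^ 2 + dist p r ^ 2 - dist q r ^ 2) / 2| ≤ dist p q * dist p r :=
    fun q r => by
      obtain ⟨h1, h2, h3⟩ := scaled_triangle zero_le_one p q r
      simp only [one_mul] at h1 h2 h3
      exact abs_euclidean_le h1 h2 h3
  have := form3_nonneg_of_arccos_add_le (dist_nonneg (x := p) (y := x))
    (dist_nonneg (x := p) (y := y)) (dist_nonneg (x := p) (y := z)) (bd x y) (bd y z) (bd z x)
    (fun hx hy hz => by
      rw [← angleAt_zero, ← angleAt_zero, ← angleAt_zero]
      have hx' := dist_pos.1 hx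
      have hy' := dist_pos.1 hy
      have hz' := dist_pos.1 hz
      exact h.comparison p x y z ⟨hx', hy', fun h => absurd h (lt_irrefl _)⟩
        ⟨hy', hz', fun h => absurd h (lt_irrefl _)⟩ ⟨hz', hx', fun h => absurd h (lt_irrefl _)⟩)
    zero_le_one zero_le_one zero_le_one
  rw [form3] at this
  linarith

/-! ### Negative lower curvature bound -/

lemma angleAt_of_neg {κ : ℝ} (hκ : κ < 0) (p x y : X) : angleAt κ p x y =
    Real.arccos ((Real.cosh (√(-κ) * dist p x) * Real.cosh (√(-κ) * dist p y) -
      Real.cosh (√(-κ) * dist x y)) /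
        (Real.sinh (√(-κ) * dist p x) * Real.sinh (√(-κ) * dist p y))) := by
  simp only [angleAt, modelAngle, not_lt.2 hκ.le, if_false, hκ, if_true]

lemma isAlexandrovSpace_of_hyperbolicInequality [CompleteSpace X] (hX : IsIntrinsic X) {κ : ℝ}
    (hκ : κ < 0) (h : HyperbolicInequality κ X) : IsAlexandrovSpace κ X := by
  refine ⟨inferInstance, hX, fun p x y z hxy hyz hzx => ?_⟩
  rw [hyperbolicInequality_iff] at h
  simp only [angleAt_of_neg hκ]
  have hk : 0 < √(-κ) := Real.sqrt_pos.2 (by linarith)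
  generalize √(-κ) = k at h hk
  have G := geodesicDist_ultraDist hX hk
  have T : ∀ u v : BddSeq X, Tendsto (fun n => Real.cosh (k * dist (u.1 n) (v.1 n)))
      (hyperfilter ℕ) (𝓝 (Real.cosh (ultraDist k u v))) := fun u v =>
    (Real.continuous_cosh.tendsto _).comp (tendsto_ultraDist k u v)
  have bd : ∀ q r : X, |Real.cosh (k * dist p q) * Real.cosh (k * dist p r) -
      Real.cosh (k * dist q r)| ≤ Real.sinh (k * dist p q) * Real.sinh (k * dist p r) :=
    fun q r => by
      obtain ⟨h1, h2, h3⟩ := scaled_triangle hk.le p q r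
      exact abs_cosh_sub_le h1 h2 h3
  have pos : ∀ {q : X}, p ≠ q → 0 < Real.sinh (k * dist p q) := fun hq =>
    Real.sinh_pos_iff.2 (mul_pos hk (dist_pos.2 hq))
  refine arccos_add_le_of_form3_nonneg (pos hxy.1) (pos hyz.1) (pos hzx.1)
    (bd x y) (bd y z) (bd z x) fun a b c ha hb hc => ?_
  simpa only [ultraDist_const] using G.hyperbolic_weighted (fun p x y z =>
    le_of_tendsto_of_tendsto' (((((T x y).add (T y z)).add (T z x)).const_mul _).const_add _)
      ((((T p x).add (T p y)).add (T p z)).pow 2) fun n => h _ _ _ _) (BddSeq.const p)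
    (BddSeq.const x) (BddSeq.const y) (BddSeq.const z) ha hb hc

lemma IsAlexandrovSpace.hyperbolicInequality {κ : ℝ} (hκ : κ < 0) (h : IsAlexandrovSpace κ X) :
    HyperbolicInequality κ X := by
  rw [hyperbolicInequality_iff]
  intro p x y z
  have hk : 0 < √(-κ) := Real.sqrt_pos.2 (by linarith)
  have hcomp := h.comparison p x y z
  simp only [angleAt_of_neg hκ, AngleDefined] at hcomp
  generalize √(-κ) = k at hcomp hk
  have bd : ∀ q r : X, |Real.cosh (k * dist p q) * Real.cosh (k * dist p r) -
      Real.cosh (k * dist q r)| ≤ Real.sinh (k * dist p q) * Real.sinh (k * dist p r) :=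
    fun q r => by
      obtain ⟨h1, h2, h3⟩ := scaled_triangle hk.le p q r
      exact abs_cosh_sub_le h1 h2 h3
  have nn : ∀ q : X, 0 ≤ Real.sinh (k * dist p q) := fun q =>
    Real.sinh_nonneg_iff.2 (by positivity)
  have ne : ∀ {q : X}, 0 < Real.sinh (k * dist p q) → p ≠ q := by
    rintro q hq rfl
    simp at hq
  have := form3_nonneg_of_arccos_add_le (nn x) (nn y) (nn z) (bd x y) (bd y z) (bd z x)
    (fun hx hy hz => hcomp ⟨ne hx, ne hy, fun h => absurd h (not_lt.2 hκ.le)⟩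
      ⟨ne hy, ne hz, fun h => absurd h (not_lt.2 hκ.le)⟩
      ⟨ne hz, ne hx, fun h => absurd h (not_lt.2 hκ.le)⟩) zero_le_one zero_le_one zero_le_one
  rw [form3] at this
  have e1 := Real.cosh_sq (k * dist p x)
  have e2 := Real.cosh_sq (k * dist p y)
  have e3 := Real.cosh_sq (k * dist p z)
  linarith

/-! ### Positive lower curvature bound -/

lemma angleAt_of_pos {κ : ℝ} (hκ : 0 < κ) (p x y : X) : angleAt κ p x y =
    Real.arccos ((Real.cos (√κ * dist x y) - Real.cos (√κ * dist p x) * Real.cos (√κ * dist p y)) /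
        (Real.sin (√κ * dist p x) * Real.sin (√κ * dist p y))) := by
  simp only [angleAt, modelAngle, hκ, if_true]

lemma abs_cos_sub_le_of_perimeter {k : ℝ} (hk : 0 < k) {p q r : X}
    (h : k * dist p q + k * dist p r + k * dist q r < 2 * Real.pi) :
    |Real.cos (k * dist q r) - Real.cos (k * dist p q) * Real.cos (k * dist p r)| ≤
      Real.sin (k * dist p q) * Real.sin (k * dist p r) := by
  obtain ⟨h1, h2, h3⟩ := scaled_triangle hk.le p q r
  exact abs_cos_sub_le h1 h2 h3 h.le

lemma scaled_dist_lt_pi {k : ℝ} (hk : 0 < k) {p q r : X}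
    (h : k * dist p q + k * dist p r + k * dist q r < 2 * Real.pi) :
    k * dist p q < Real.pi := by
  obtain ⟨h1, -, -⟩ := scaled_triangle hk.le p q r
  linarith

lemma perimeter_lt_iff {κ : ℝ} (hκ : 0 < κ) (p q r : X) :
    dist p q + dist p r + dist q r < 2 * Real.pi / √κ ↔
      √κ * dist p q + √κ * dist p r + √κ * dist q r < 2 * Real.pi := by
  rw [lt_div_iff₀ (Real.sqrt_pos.2 hκ), mul_comm, mul_add, mul_add]

lemma isAlexandrovSpace_of_sphericalInequality [CompleteSpace X] (hX : IsIntrinsic X) {κ : ℝ}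
    (hκ : 0 < κ) (h : SphericalInequality κ X) : IsAlexandrovSpace κ X := by
  refine ⟨inferInstance, hX, fun p x y z hxy hyz hzx => ?_⟩
  rw [sphericalInequality_iff] at h
  simp only [angleAt_of_pos hκ]
  have pxy := (perimeter_lt_iff hκ p x y).1 (hxy.2.2 hκ)
  have pyz := (perimeter_lt_iff hκ p y z).1 (hyz.2.2 hκ)
  have pzx := (perimeter_lt_iff hκ p z x).1 (hzx.2.2 hκ)
  have hk : 0 < √κ := Real.sqrt_pos.2 hκ
  generalize √κ = k at h hk pxy pyz pzx
  have G := geodesicDist_ultraDist hX hk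
  have T : ∀ u v : BddSeq X, Tendsto (fun n => Real.cos (k * dist (u.1 n) (v.1 n)))
      (hyperfilter ℕ) (𝓝 (Real.cos (ultraDist k u v))) := fun u v =>
    (Real.continuous_cos.tendsto _).comp (tendsto_ultraDist k u v)
  have pos : ∀ {q r : X}, p ≠ q → k * dist p q + k * dist p r + k * dist q r < 2 * Real.pi →
      0 < Real.sin (k * dist p q) := fun hq hr =>
    Real.sin_pos_of_pos_of_lt_pi (mul_pos hk (dist_pos.2 hq)) (scaled_dist_lt_pi hk hr)
  refine arccos_add_le_of_form3_nonneg (pos hxy.1 pxy) (pos hyz.1 pyz) (pos hzx.1 pzx)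
    (abs_cos_sub_le_of_perimeter hk pxy) (abs_cos_sub_le_of_perimeter hk pyz)
    (abs_cos_sub_le_of_perimeter hk pzx) fun a b c ha hb hc => ?_
  have := G.spherical_weighted (fun p x y z =>
    le_of_tendsto_of_tendsto' ((((T p x).add (T p y)).add (T p z)).pow 2)
      (((((T x y).add (T y z)).add (T z x)).const_mul _).const_add _) fun n => h _ _ _ _)
    (p := BddSeq.const p) (x := BddSeq.const x) (y := BddSeq.const y) (z := BddSeq.const z)
    (by simpa only [ultraDist_const] using pxy) (by simpa only [ultraDist_const] using pyz)
    (by simpa only [ultraDist_const] using pzx) ha hb hc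
  simpa only [ultraDist_const] using this

lemma IsAlexandrovSpace.sphericalWeighted {κ : ℝ} (hκ : 0 < κ) (h : IsAlexandrovSpace κ X) :
    SphericalWeighted fun x y : X => √κ * dist x y := by
  intro p x y z pxy pyz pzx a b c ha hb hc
  dsimp only at pxy pyz pzx ⊢
  have hcomp := h.comparison p x y z
  simp only [angleAt_of_pos hκ, AngleDefined, perimeter_lt_iff hκ] at hcomp
  have hk : 0 < √κ := Real.sqrt_pos.2 hκ
  generalize √κ = k at hcomp hk pxy pyz pzx
  have nn : ∀ {q r : X}, k * dist p q + k * dist p r + k * dist q r < 2 * Real.pi →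
      0 ≤ Real.sin (k * dist p q) := fun hr =>
    Real.sin_nonneg_of_nonneg_of_le_pi (by positivity) (scaled_dist_lt_pi hk hr).le
  have ne : ∀ {q : X}, 0 < Real.sin (k * dist p q) → p ≠ q := by
    rintro q hq rfl
    simp at hq
  exact form3_nonneg_of_arccos_add_le (nn pxy) (nn pyz) (nn pzx)
    (abs_cos_sub_le_of_perimeter hk pxy) (abs_cos_sub_le_of_perimeter hk pyz)
    (abs_cos_sub_le_of_perimeter hk pzx) (fun hx hy hz => hcomp ⟨ne hx, ne hy, fun _ => pxy⟩
      ⟨ne hy, ne hz, fun _ => pyz⟩ ⟨ne hz, ne hx, fun _ => pzx⟩) ha hb hc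

/-- The perimeter restriction is strict, hence holds along the ultrafilter for the coordinates; the
form is continuous in the six distances. -/
lemma SphericalWeighted.ultraDist {k : ℝ}
    (W : SphericalWeighted fun x y : X => k * dist x y) :
    SphericalWeighted (ultraDist (X := X) k) := by
  intro p x y z pxy pyz pzx a b c ha hb hc
  have T := tendsto_ultraDist (X := X) k
  have cont : Continuous fun q : ℝ × ℝ × ℝ × ℝ × ℝ × ℝ =>
      form3 (Real.sin q.1) (Real.sin q.2.1) (Real.sin q.2.2.1)
        (Real.cos q.2.2.2.1 - Real.cos q.1 * Real.cos q.2.1)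
        (Real.cos q.2.2.2.2.1 - Real.cos q.2.1 * Real.cos q.2.2.1)
        (Real.cos q.2.2.2.2.2 - Real.cos q.2.2.1 * Real.cos q.1) a b c := by
    unfold form3
    fun_prop
  have lim := (cont.tendsto _).comp ((T p x).prodMk_nhds ((T p y).prodMk_nhds
    ((T p z).prodMk_nhds ((T x y).prodMk_nhds ((T y z).prodMk_nhds (T z x))))))
  refine ge_of_tendsto lim ?_
  filter_upwards [(((T p x).add (T p y)).add (T x y)).eventually_lt_const pxy,
    (((T p y).add (T p z)).add (T y z)).eventually_lt_const pyz,
    (((T p z).add (T p x)).add (T z x)).eventually_lt_const pzx] with n h1 h2 h3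
  exact W _ _ _ _ h1 h2 h3 a b c ha hb hc

lemma IsAlexandrovSpace.sphericalInequality {κ : ℝ} (hκ : 0 < κ) (h : IsAlexandrovSpace κ X)
    (hdiam : ∀ x y : X, dist x y ≤ Real.pi / √κ) : SphericalInequality κ X := by
  rw [sphericalInequality_iff]
  intro p x y z
  have W := (h.sphericalWeighted hκ).ultraDist
  have hk : 0 < √κ := Real.sqrt_pos.2 hκ
  have hdiam' : ∀ x y : X, √κ * dist x y ≤ Real.pi := fun x y => by
    have := hdiam x y
    rwa [le_div_iff₀ hk, mul_comm] at this
  have := W.form3_nonneg (geodesicDist_ultraDist h.intrinsic hk)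
    (fun u v => le_of_tendsto' (tendsto_ultraDist _ u v) fun n => hdiam' _ _)
    (BddSeq.const p) (BddSeq.const x) (BddSeq.const y) (BddSeq.const z)
  simp only [ultraDist_const] at this
  rw [form3] at this
  have e1 := Real.sin_sq_add_cos_sq (√κ * dist p x)
  have e2 := Real.sin_sq_add_cos_sq (√κ * dist p y)
  have e3 := Real.sin_sq_add_cos_sq (√κ * dist p z)
  linarith

end

end AlexandrovCBB

theorem mainTheorem2 {X : Type*} [MetricSpace X] [CompleteSpace X]
    (hX : AlexandrovCBB.IsIntrinsic X) :
    -- `κ = 1`; the diameter bound is needed in one direction only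
    ((∀ (p : X) (x : Fin 3 → X),
        (∑ i, Real.cos (dist p (x i))) ^ 2 ≤ ∑ i, ∑ j, Real.cos (dist (x i) (x j))) →
      AlexandrovCBB.IsAlexandrovSpace 1 X) ∧
    ((∀ x y : X, dist x y ≤ Real.pi) →
      (AlexandrovCBB.IsAlexandrovSpace 1 X ↔
        ∀ (p : X) (x : Fin 3 → X),
          (∑ i, Real.cos (dist p (x i))) ^ 2 ≤ ∑ i, ∑ j, Real.cos (dist (x i) (x j)))) ∧
    -- `κ = -1`
    (AlexandrovCBB.IsAlexandrovSpace (-1) X ↔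
      ∀ (p : X) (x : Fin 3 → X),
        (∑ i, Real.cosh (dist p (x i))) ^ 2 ≥ ∑ i, ∑ j, Real.cosh (dist (x i) (x j))) ∧
    -- arbitrary `κ`
    (∀ κ : ℝ, 0 < κ →
      (AlexandrovCBB.SphericalInequality κ X → AlexandrovCBB.IsAlexandrovSpace κ X) ∧
      ((∀ x y : X, dist x y ≤ Real.pi / √κ) →
        (AlexandrovCBB.IsAlexandrovSpace κ X ↔ AlexandrovCBB.SphericalInequality κ X))) ∧
    (AlexandrovCBB.IsAlexandrovSpace 0 X ↔ AlexandrovCBB.EuclideanInequality X) ∧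
    (∀ κ : ℝ, κ < 0 →
      (AlexandrovCBB.IsAlexandrovSpace κ X ↔ AlexandrovCBB.HyperbolicInequality κ X)) := by
  have pos : ∀ κ : ℝ, 0 < κ →
      (AlexandrovCBB.SphericalInequality κ X → AlexandrovCBB.IsAlexandrovSpace κ X) ∧
      ((∀ x y : X, dist x y ≤ Real.pi / √κ) →
        (AlexandrovCBB.IsAlexandrovSpace κ X ↔ AlexandrovCBB.SphericalInequality κ X)) :=
    fun κ hκ => ⟨AlexandrovCBB.isAlexandrovSpace_of_sphericalInequality hX hκ, fun hd =>
      ⟨fun h => h.sphericalInequality hκ hd,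
        AlexandrovCBB.isAlexandrovSpace_of_sphericalInequality hX hκ⟩⟩
  have neg : ∀ κ : ℝ, κ < 0 →
      (AlexandrovCBB.IsAlexandrovSpace κ X ↔ AlexandrovCBB.HyperbolicInequality κ X) :=
    fun κ hκ => ⟨fun h => h.hyperbolicInequality hκ,
      AlexandrovCBB.isAlexandrovSpace_of_hyperbolicInequality hX hκ⟩
  have pos_one := pos 1 one_pos
  have neg_one := neg (-1) (by norm_num)
  simp only [AlexandrovCBB.SphericalInequality, Real.sqrt_one, one_mul, div_one] at pos_one
  simp only [AlexandrovCBB.HyperbolicInequality, neg_neg, Real.sqrt_one, one_mul] at neg_one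
  exact ⟨pos_one.1, pos_one.2, neg_one, pos,
    ⟨fun h => h.euclideanInequality,
      AlexandrovCBB.isAlexandrovSpace_zero_of_inequality hX⟩, neg⟩
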